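/- Let $\lambda_1=(-\tfrac12,\tfrac{\sqrt3}{2})$, $\lambda_2=(\tfrac12,\tfrac{\sqrt3}{2})$, let $L=\mathbb Z\lambda_1\oplus\mathbb Z\lambda_2$ be the triangular lattice, in which each $x$ has the six neighbours $x\pm\lambda_1,\ x\pm\lambda_2,\ x\pm(\lambda_1-\lambda_2)$, and let $\tau(j\lambda_1+j'\lambda_2)\equiv j+2j' \pmod 3$. The hexagonal lattice is $H=\{x\in L:\tau(x)\ne 1\}$, where $x$ has the three neighbours $x+\lambda_2,\ x-\lambda_1,\ x+\lambda_1-\lambda_2$ if $\tau(x)=0$, and $x+\lambda_1,\ x-\lambda_2,\ x-\lambda_1+\lambda_2$ if $\tau(x)=2$. Write $p(n;x,y)$ for the $n$-step transition probabilities of the simple random walk on $H$ or on $L$ (each step goes to a uniformly chosen neighbour), and $\mathcal M=\operatorname{int}\operatorname{conv}\{\pm e_1,\pm e_2,\pm(e_1-e_2)\}\subset\mathbb R^2$. **Hexagonal lattice.** The simple random walk on $H$ is irreducible with period $2$, and its periodicity classes from $0$, namely $X_j=\{x\in H: p(j+2k;0,x)>0\text{ for some }k\ge 0\}$, are $X_0=\{\tau=0\}$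 and $X_1=\{\tau=2\}$. Put $$\kappa(u)=\tfrac13+\tfrac29\cosh u_1+\tfrac29\cosh u_2+\tfrac29\cosh(u_1-u_2),\qquad \phi(\delta)=\max_{u\in\mathbb R^2}\big(\langle u,\delta\rangle-\log\kappa(u)\big)\quad(\delta\in\mathcal M),$$ and for $x=j_1\lambda_1+j_2\lambda_2\in H$ and $n\ge 1$ put $$\delta=\frac{2}{n}\Big(\frac{2j_1+j_2}{3}\,e_1+\frac{-j_1+j_2}{3}\,e_2\Big).$$ For every $\epsilon>0$ and all integers $n\ge1$, $j\in\{0,1\}$ and $x\in X_j$: if $n\equiv j\pmod 2$, then $$p(n;0,x)=(2\pi n)^{-1}e^{-\frac n2\phi(\delta)}\big(3\sqrt3+\mathcal O(\|\delta\|_1)+\mathcal O(n^{-1})\big),$$ uniformly with respect to $n$ and $x$ such that $\delta\in\mathcal M$ and $\operatorname{dist}(\delta,\partial\mathcal M)\ge\epsilon$ (the implied constants depend only on $\epsilon$); if $n\not\equiv j\pmod 2$, then $p(n;0,x)=0$. **Triangular lattice.** Put $\kappa(u)=\tfrac13\cosh u_1+\tfrac13\cosh u_2+\tfrac13\cosh(u_1-u_2)$,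 define $\phi$ on $\mathcal M$ from this $\kappa$ as above, and for $x=j_1\lambda_1+j_2\lambda_2\in L$ and $n\ge1$ put $\delta=\frac{j_1}{n}e_1+\frac{j_2}{n}e_2$. For every $\epsilon>0$, $$p(n;0,x)=(2\pi n)^{-1}e^{-n\phi(\delta)}\big(\sqrt3+\mathcal O(\|\delta\|_1)+\mathcal O(n^{-1})\big),$$ uniformly with respect to integers $n\ge1$ and $x\in L$ such that $\delta\in\mathcal M$ and $\operatorname{dist}(\delta,\partial\mathcal M)\ge\epsilon$ (the implied constants depend only on $\epsilon$). -/

import Mathlib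

noncomputable section

namespace LatticeWalk

/-! ## Random walks -/

/-- `nStep p n x y` is the `n`-step transition probability `p(n; x, y)` of the walk with one-step
transition function `p`. -/
def nStep {V : Type} [DecidableEq V] (p : V → V → ℝ) : ℕ → V → V → ℝ
  | 0, x, y => if x = y then 1 else 0
  | n + 1, x, y => ∑' z, nStep p n x z * p z y

/-- Every vertex can be reached from every vertex with positive probability. -/
def IsIrreducibleWalk {V : Type} [DecidableEq V] (p : V → V → ℝ) : Prop :=
  ∀ x y, ∃ n, 0 < nStep p n x y

/-- The period at `o` is `r`, that is, `r = gcd {n ≥ 1 : p(n; o, o) > 0}`, written through the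
universal property of the greatest common divisor. -/
def IsPeriod {V : Type} [DecidableEq V] (p : V → V → ℝ) (o : V) (r : ℕ) : Prop :=
  ∀ d : ℕ, d ∣ r ↔ ∀ n, 0 < n → 0 < nStep p n o o → d ∣ n

/-- The class `X_j` of a walk of period `r` started at `o`. -/
def periodClass {V : Type} [DecidableEq V] (p : V → V → ℝ) (o : V) (r j : ℕ) : Set V :=
  {x | ∃ k : ℕ, 0 < nStep p (j + k * r) o x}

/-! ## Exponential generating function, polygon and rate function of a step law on `ℤ²` -/

/-- The inclusion of `ℤ²` in the Euclidean plane. -/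
def toPlane (v : ℤ × ℤ) : EuclideanSpace ℝ (Fin 2) := !₂[(v.1 : ℝ), (v.2 : ℝ)]

/-- `κ(u) = ∑_v p(v) e^{⟨u, v⟩}`. -/
def kappa (law : ℤ × ℤ → ℝ) (u : EuclideanSpace ℝ (Fin 2)) : ℝ :=
  ∑' v : ℤ × ℤ, law v * Real.exp (inner ℝ u (toPlane v))

/-- The set `M`: the interior of the convex hull of the support of the step law. -/
def stepBody (law : ℤ × ℤ → ℝ) : Set (EuclideanSpace ℝ (Fin 2)) :=
  interior (convexHull ℝ (toPlane '' {v | 0 < law v}))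

/-- `φ(δ) = max {⟨u, δ⟩ - log κ(u) : u ∈ ℝ²}`, used for `δ ∈ M`. -/
def rate (law : ℤ × ℤ → ℝ) (δ : EuclideanSpace ℝ (Fin 2)) : ℝ :=
  sSup (Set.range fun u : EuclideanSpace ℝ (Fin 2) => inner ℝ u δ - Real.log (kappa law u))

/-- The norm `‖δ‖₁`. -/
def l1Norm (δ : EuclideanSpace ℝ (Fin 2)) : ℝ := |δ 0| + |δ 1|

/-! ## The triangular lattice

The point `j λ₁ + j' λ₂` of the triangular lattice, where `λ₁ = (-1/2, √3/2)` and
`λ₂ = (1/2, √3/2)`, is represented by its pair of coordinates `(j, j')`. -/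

/-- The six vectors `±λ₁`, `±λ₂`, `±(λ₁ - λ₂)` of length one, in coordinates. -/
def sixSteps : Finset (ℤ × ℤ) := {(1, 0), (-1, 0), (0, 1), (0, -1), (1, -1), (-1, 1)}

/-- The step law of the simple random walk on the triangular lattice. -/
def triLaw (v : ℤ × ℤ) : ℝ := if v ∈ sixSteps then 1 / 6 else 0

/-- The transition function of the simple random walk on the triangular lattice. -/
def triStep (x y : ℤ × ℤ) : ℝ := triLaw (y - x)

/-- `δ = (j / n, j' / n)` for `x = j λ₁ + j' λ₂`. -/
def triDelta (n : ℕ) (x : ℤ × ℤ) : EuclideanSpace ℝ (Fin 2) :=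
  !₂[(x.1 : ℝ) / n, (x.2 : ℝ) / n]

/-! ## The hexagonal lattice -/

/-- `τ(j λ₁ + j' λ₂) = j + 2 j' mod 3`. -/
def tau (x : ℤ × ℤ) : ZMod 3 := (x.1 : ZMod 3) + 2 * (x.2 : ZMod 3)

/-- The hexagonal lattice: the vertices of the triangular lattice with `τ ≠ 1`. -/
abbrev Hex : Type := {x : ℤ × ℤ // tau x ≠ 1}

/-- The vertex `0` of the hexagonal lattice. -/
def hexZero : Hex := ⟨(0, 0), by decide⟩

/-- The three vectors leading from `x` to its neighbours in the hexagonal lattice: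
`λ₂`, `-λ₁`, `λ₁ - λ₂` if `τ(x) = 0`, and `λ₁`, `-λ₂`, `λ₂ - λ₁` if `τ(x) = 2`. -/
def hexNeighborSteps (x : Hex) : Finset (ℤ × ℤ) :=
  if tau x.1 = 0 then {(0, 1), (-1, 0), (1, -1)} else {(1, 0), (0, -1), (-1, 1)}

/-- The transition function of the simple random walk on the hexagonal lattice. -/
def hexStep (x y : Hex) : ℝ := if y.1 - x.1 ∈ hexNeighborSteps x then 1 / 3 else 0

/-- The step law of the walk on the class `τ = 0` obtained by observing the hexagonal walk at even
times, in the coordinates that send `(λ₁ + λ₂, 2 λ₂ - λ₁)` to the standard basis of `ℤ²`. -/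
def hexTwoStepLaw (v : ℤ × ℤ) : ℝ :=
  if v = 0 then 1 / 3 else if v ∈ sixSteps then 1 / 9 else 0

/-- The position of `x = j λ₁ + j' λ₂` in these coordinates, `((2 j + j') / 3, (-j + j') / 3)`,
divided by the number `n / 2` of two-step moves made in time `n`. -/
def hexDelta (n : ℕ) (x : Hex) : EuclideanSpace ℝ (Fin 2) :=
  !₂[(2 * (x.1.1 : ℝ) + (x.1.2 : ℝ)) / 3 / ((n : ℝ) / 2),
    (-(x.1.1 : ℝ) + (x.1.2 : ℝ)) / 3 / ((n : ℝ) / 2)]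

end LatticeWalk

end

noncomputable section

namespace LatticeWalk

open MeasureTheory Set

/-! ## Gaussian integrals over the plane -/

/-! Both statements reduce to a local limit theorem for walks on `ℤ²` with mass `a` at the origin
and `b` at each of six steps: the triangular walk is such a walk, and so is the hexagonal walk
observed on `τ = 0` at even times.

The exponential factor comes from tilting. Weighting a step `v` by `e^{⟨u,v⟩} / κ(u)` changes the
`m`-step probability at `x` exactly by the factor `e^{⟨u,x⟩} / κ(u)^m`. If `u` maximizes `⟨u,δ⟩ -
log κ(u)`, the tilted law has mean `δ`, and for `x = mδ` the factor removed is `e^{-mφ(δ)}`. Keeping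
`δ` at distance `ε` from the boundary confines `u` to a fixed compact set, hence bounds the tilted
masses of the six steps from below; all constants depend only on these bounds
(`IsLazy.exists_maximizer`, `IsLazy.le_tilt`).

What remains is the tilted probability at its mean, an integral over `[-π, π]²` of the `m`-th power
of a centred characteristic function. It is compared with the Gaussian integral `2π / (m √det)`. The
error is `O(m⁻²)` rather than `O(m^{-3/2})` because the cubic term of the expansion is imaginary, so
after taking real parts it contributes only through its square (`exists_abs_re_pow_mul_sub_exp_le`,
`exists_abs_setIntegral_trigSum_sub_le`). At `u = 0` the covariance determinant is `12 b²`; since `u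
= O(‖δ‖₁)`, replacing the determinant by this value costs `O(‖δ‖₁)` and produces `√3` and `3√3 / 2`.
The latter is doubled on passing from `m` to `n = 2m`.

At odd times the last hexagonal step averages over three even vertices. This inserts one extra
characteristic function into the integral, and a correction factor `1 + O(‖u‖₁)` that also absorbs
the half step in `n/2 = m + 1/2`. -/

theorem integral_exp_neg_quadratic_shift {α : ℝ} (hα : 0 < α) (β y : ℝ) :
    ∫ x : ℝ, Real.exp (-(α * x ^ 2 + 2 * β * x * y)) =
      √(Real.pi / α) * Real.exp (β ^ 2 / α * y ^ 2) := by
  have h : ∀ x : ℝ, Real.exp (-(α * x ^ 2 + 2 * β * x * y)) =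
      Real.exp (-α * (x + β * y / α) ^ 2) * Real.exp (β ^ 2 / α * y ^ 2) := by
    intro x
    rw [← Real.exp_add]
    congr 1
    field_simp
    ring
  simp_rw [h]
  rw [integral_mul_const, integral_add_right_eq_self (fun x : ℝ => Real.exp (-α * x ^ 2)),
    integral_gaussian]

theorem integrable_exp_neg_sq_add_sq {c : ℝ} (hc : 0 < c) :
    Integrable fun θ : ℝ × ℝ => Real.exp (-c * (θ.1 ^ 2 + θ.2 ^ 2)) := by
  have h := (integrable_exp_neg_mul_sq hc).mul_prod (integrable_exp_neg_mul_sq hc)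
  refine h.congr (Filter.Eventually.of_forall fun θ => ?_)
  simp only
  rw [← Real.exp_add]
  congr 1
  ring

theorem integral_exp_neg_sq_add_sq {c : ℝ} (hc : 0 < c) :
    ∫ θ : ℝ × ℝ, Real.exp (-c * (θ.1 ^ 2 + θ.2 ^ 2)) = Real.pi / c := by
  have h := integral_prod_mul (μ := (volume : Measure ℝ)) (ν := (volume : Measure ℝ))
    (fun x : ℝ => Real.exp (-c * x ^ 2)) (fun x : ℝ => Real.exp (-c * x ^ 2))
  rw [integral_gaussian, Real.mul_self_sqrt (by positivity)] at h
  rw [← h]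
  refine integral_congr_ae (Filter.Eventually.of_forall fun θ => ?_)
  simp only
  rw [← Real.exp_add]
  congr 1
  ring

/-- The quadratic form with matrix `!![α, β; β, γ]`. -/
def quadForm (α β γ : ℝ) (θ : ℝ × ℝ) : ℝ := α * θ.1 ^ 2 + 2 * β * θ.1 * θ.2 + γ * θ.2 ^ 2

/-- The vector `(-β, α)` is chosen because the form takes there the value `α (αγ - β²)`, a multiple
of the determinant. -/
theorem quadForm_coercive {c α β γ : ℝ} (hc : 0 < c)
    (h : ∀ θ, c * (θ.1 ^ 2 + θ.2 ^ 2) ≤ quadForm α β γ θ) :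
    c ≤ α ∧ c ^ 2 ≤ α * γ - β ^ 2 := by
  have h1 := h (1, 0)
  have h2 := h (-β, α)
  simp only [quadForm] at h1 h2
  have h3 : c ≤ α := by linarith
  have hα : 0 < α := by linarith
  refine ⟨h3, ?_⟩
  have h4 : α * (c * α) ≤ α * (α * γ - β ^ 2) := by nlinarith [mul_nonneg hc.le (sq_nonneg β)]
  have h5 := le_of_mul_le_mul_left h4 hα
  nlinarith

theorem integrable_exp_neg_quadForm {c α β γ : ℝ} (hc : 0 < c)
    (h : ∀ θ, c * (θ.1 ^ 2 + θ.2 ^ 2) ≤ quadForm α β γ θ) :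
    Integrable fun θ : ℝ × ℝ => Real.exp (-quadForm α β γ θ) := by
  refine (integrable_exp_neg_sq_add_sq hc).mono' ?_ (Filter.Eventually.of_forall fun θ => ?_)
  · unfold quadForm
    fun_prop
  · rw [Real.norm_eq_abs, abs_of_pos (Real.exp_pos _)]
    have := h θ
    exact Real.exp_le_exp.2 (by linarith)

theorem integral_exp_neg_quadForm {c α β γ : ℝ} (hc : 0 < c)
    (h : ∀ θ, c * (θ.1 ^ 2 + θ.2 ^ 2) ≤ quadForm α β γ θ) :
    ∫ θ : ℝ × ℝ, Real.exp (-quadForm α β γ θ) = Real.pi / √(α * γ - β ^ 2) := by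
  obtain ⟨h1, h2⟩ := quadForm_coercive hc h
  have hα : 0 < α := by linarith
  have hD : 0 < α * γ - β ^ 2 := lt_of_lt_of_le (by positivity) h2
  have hint := integrable_exp_neg_quadForm hc h
  rw [Measure.volume_eq_prod] at hint ⊢
  rw [integral_prod_symm _ hint]
  have hi : ∀ y : ℝ, ∫ x : ℝ, Real.exp (-quadForm α β γ (x, y)) =
      √(Real.pi / α) * Real.exp (-((α * γ - β ^ 2) / α) * y ^ 2) := by
    intro y
    have e : ∀ x : ℝ, Real.exp (-quadForm α β γ (x, y)) =
        Real.exp (-(α * x ^ 2 + 2 * β * x * y)) * Real.exp (-(γ * y ^ 2)) := by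
      intro x
      rw [← Real.exp_add]
      congr 1
      simp only [quadForm]
      ring
    simp_rw [e]
    rw [integral_mul_const, integral_exp_neg_quadratic_shift hα, mul_assoc, ← Real.exp_add]
    congr 2
    field_simp
    ring
  simp only [hi]
  rw [integral_const_mul, integral_gaussian, ← Real.sqrt_mul (by positivity)]
  have : Real.pi / α * (Real.pi / ((α * γ - β ^ 2) / α)) = Real.pi ^ 2 / (α * γ - β ^ 2) := by
    field_simp
  rw [this, Real.sqrt_div (by positivity), Real.sqrt_sq Real.pi_pos.le]

/-! ## Comparison of powers with a Gaussian -/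

theorem norm_pow_sub_pow_le {z w : ℂ} {M : ℝ} (hz : ‖z‖ ≤ M) (hw : ‖w‖ ≤ M) (m : ℕ) :
    ‖z ^ m - w ^ m‖ ≤ m * M ^ (m - 1) * ‖z - w‖ := by
  rw [← (Commute.all z w).geom_sum₂_mul, norm_mul]
  refine mul_le_mul_of_nonneg_right ((norm_sum_le _ _).trans ?_) (norm_nonneg _)
  have hM : 0 ≤ M := (norm_nonneg z).trans hz
  calc ∑ i ∈ Finset.range m, ‖z ^ i * w ^ (m - 1 - i)‖
      ≤ ∑ i ∈ Finset.range m, M ^ (m - 1) := by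
        refine Finset.sum_le_sum fun i hi => ?_
        have hi' : i ≤ m - 1 := by have := Finset.mem_range.1 hi; omega
        rw [norm_mul, norm_pow, norm_pow]
        calc ‖z‖ ^ i * ‖w‖ ^ (m - 1 - i) ≤ M ^ i * M ^ (m - 1 - i) := by gcongr
          _ = M ^ (m - 1) := by rw [← pow_add]; congr 1; omega
    _ = m * M ^ (m - 1) := by simp

/-- Half of the exponential absorbs the power, by `x ^ k / k! ≤ e ^ x` at `x = c s / 2`; the other
half stays available for integration. -/
theorem pow_mul_exp_neg_le (k : ℕ) {c s : ℝ} (hc : 0 < c) (hs : 0 ≤ s) :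
    s ^ k * Real.exp (-(c * s)) ≤ k.factorial * (2 / c) ^ k * Real.exp (-(c * s / 2)) := by
  have h := Real.pow_div_factorial_le_exp (x := c * s / 2) (by positivity) k
  rw [div_le_iff₀ (by positivity)] at h
  have e1 : s ^ k = (2 / c) ^ k * (c * s / 2) ^ k := by
    rw [← mul_pow]; congr 1; field_simp
  have e2 : Real.exp (-(c * s)) = Real.exp (-(c * s / 2)) * Real.exp (-(c * s / 2)) := by
    rw [← Real.exp_add]; congr 1; ring
  have e3 : Real.exp (c * s / 2) * Real.exp (-(c * s / 2)) = 1 := by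
    rw [← Real.exp_add]; simp
  have hE := Real.exp_pos (-(c * s / 2))
  calc s ^ k * Real.exp (-(c * s))
      = (2 / c) ^ k * (c * s / 2) ^ k * (Real.exp (-(c * s / 2)) * Real.exp (-(c * s / 2))) := by
        rw [e1, e2]
    _ ≤ (2 / c) ^ k * (Real.exp (c * s / 2) * k.factorial) *
          (Real.exp (-(c * s / 2)) * Real.exp (-(c * s / 2))) := by gcongr
    _ = k.factorial * (2 / c) ^ k * (Real.exp (c * s / 2) * Real.exp (-(c * s / 2))) *
          Real.exp (-(c * s / 2)) := by ring
    _ = _ := by rw [e3, mul_one]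

/-- A function `F` close to `exp (-b - i t)` and a factor `F₁` close to `1 + i l`: the real part of
`F ^ m * F₁` is close to `exp (-m b)`. -/
theorem exists_abs_re_pow_mul_sub_exp_le {c K r₀ : ℝ} (hc : 0 < c) (hK : 0 < K) :
    ∃ C : ℝ, 0 < C ∧ ∀ (m : ℕ) (r b t l : ℝ) (F F₁ : ℂ), 0 < m → 0 ≤ r → r ≤ r₀ →
      ‖F‖ ≤ Real.exp (-(c * r)) → c * r ≤ b →
      ‖F - Complex.exp (-b - t * Complex.I)‖ ≤ K * r ^ 2 → t ^ 2 ≤ K * r ^ 3 → l ^ 2 ≤ K * r →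
      ‖F₁‖ ≤ 1 → ‖F₁ - 1 - l * Complex.I‖ ≤ K * r →
      |(F ^ m * F₁).re - Real.exp (-(m * b))| ≤ C / m * Real.exp (-(c * (m * r) / 2)) := by
  set A := K * Real.exp (c * r₀) + K with hA
  have hA0 : 0 < A := by positivity
  -- The errors below are `s`, `s²`, `s³` times `e^{-cs} / m` with `s = m r` and coefficients `K`,
  -- `A`, `K`; `pow_mul_exp_neg_le` supplies the factors `k! (2 / c)^k`.
  refine ⟨K * (1 * (2 / c)) + A * (2 * (2 / c) ^ 2) + K * (6 * (2 / c) ^ 3), by positivity, ?_⟩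
  intro m r b t l F F₁ hm hr hr0 hF hb hFG ht hl hF1 hF1l
  have hm' : (0 : ℝ) < m := by exact_mod_cast hm
  set G : ℂ := Complex.exp (-b - t * Complex.I) with hG
  have hGn : ‖G‖ = Real.exp (-b) := by
    rw [hG, Complex.norm_exp]
    simp
  have hGle : ‖G‖ ≤ Real.exp (-(c * r)) := by
    rw [hGn]; exact Real.exp_le_exp.2 (by linarith)
  have hpow : Real.exp (-(c * r)) ^ m = Real.exp (-(c * (m * r))) := by
    rw [← Real.exp_nat_mul]; congr 1; ring
  have hE := Real.exp_pos (-(c * (m * r)))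
  have hGm : G ^ m = Complex.exp (-(m * b : ℝ) - (m * t : ℝ) * Complex.I) := by
    rw [hG, ← Complex.exp_nat_mul]; congr 1; push_cast; ring
  have hGmn : ‖G ^ m‖ ≤ Real.exp (-(c * (m * r))) := by
    rw [norm_pow, ← hpow]; gcongr
  -- The difference of powers leaves exponent `m - 1`; restoring the missing factor costs `e^{c
  -- r₀}`.
  have h1 : ‖F ^ m - G ^ m‖ ≤ m * (K * Real.exp (c * r₀)) * r ^ 2 * Real.exp (-(c * (m * r))) := by
    refine (norm_pow_sub_pow_le hF hGle m).trans ?_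
    have e : Real.exp (-(c * r)) ^ (m - 1) ≤ Real.exp (c * r₀) * Real.exp (-(c * (m * r))) := by
      rw [← Real.exp_nat_mul, ← Real.exp_add, Nat.cast_sub hm]
      refine Real.exp_le_exp.2 ?_
      have := mul_le_mul_of_nonneg_left hr0 hc.le
      push_cast
      nlinarith
    calc (m : ℝ) * Real.exp (-(c * r)) ^ (m - 1) * ‖F - G‖
        ≤ m * (Real.exp (c * r₀) * Real.exp (-(c * (m * r)))) * (K * r ^ 2) := by gcongr
      _ = _ := by ring
  have h2 : ‖G ^ m * (F₁ - 1 - l * Complex.I)‖ ≤ K * r * Real.exp (-(c * (m * r))) := by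
    rw [norm_mul, mul_comm]; gcongr
  -- The terms of first order in `t` and in `l` are imaginary and disappear here; only `m² t²` and
  -- `m l t` survive.
  have h3 : (G ^ m * (1 + l * Complex.I)).re - Real.exp (-(m * b)) =
      Real.exp (-(m * b)) * ((Real.cos (m * t) - 1) + l * Real.sin (m * t)) := by
    rw [hGm, Complex.mul_re, Complex.exp_re, Complex.exp_im]
    simp
    ring
  have hmb : Real.exp (-(m * b)) ≤ Real.exp (-(c * (m * r))) := by
    refine Real.exp_le_exp.2 ?_
    have := mul_le_mul_of_nonneg_left hb hm'.le
    linarith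
  have hlt : |l| * |t| ≤ K * r ^ 2 := by
    rw [← abs_mul]
    refine abs_le_of_sq_le_sq ?_ (by positivity)
    calc (l * t) ^ 2 = l ^ 2 * t ^ 2 := by ring
      _ ≤ (K * r) * (K * r ^ 3) := by gcongr
      _ = (K * r ^ 2) ^ 2 := by ring
  have h4 : |(G ^ m * (1 + l * Complex.I)).re - Real.exp (-(m * b))| ≤
      Real.exp (-(c * (m * r))) * (K * (m ^ 2 * r ^ 3) + m * (K * r ^ 2)) := by
    rw [h3, abs_mul, abs_of_pos (Real.exp_pos _)]
    gcongr
    refine (abs_add_le _ _).trans (add_le_add ?_ ?_)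
    · have hcos := Real.one_sub_sq_div_two_le_cos (x := m * t)
      rw [abs_sub_comm, abs_of_nonneg (by linarith [Real.cos_le_one (m * t)])]
      have : (m : ℝ) ^ 2 * t ^ 2 ≤ m ^ 2 * (K * r ^ 3) := by gcongr
      nlinarith [mul_nonneg (sq_nonneg (m : ℝ)) (sq_nonneg t)]
    · rw [abs_mul]
      calc |l| * |Real.sin (m * t)| ≤ |l| * |m * t| := by
            gcongr |l| * ?_
            exact Real.abs_sin_le_abs
        _ = m * (|l| * |t|) := by rw [abs_mul, abs_of_pos hm']; ring
        _ ≤ _ := by gcongr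
  have hsplit : F ^ m * F₁ = (F ^ m - G ^ m) * F₁ + G ^ m * (F₁ - 1 - l * Complex.I) +
      G ^ m * (1 + l * Complex.I) := by ring
  have h5 : |(F ^ m * F₁).re - Real.exp (-(m * b))| ≤
      Real.exp (-(c * (m * r))) *
        (m * (K * Real.exp (c * r₀)) * r ^ 2 + K * r + K * (m ^ 2 * r ^ 3) + m * (K * r ^ 2)) := by
    rw [hsplit, Complex.add_re, Complex.add_re]
    have a1 : |((F ^ m - G ^ m) * F₁).re| ≤
        m * (K * Real.exp (c * r₀)) * r ^ 2 * Real.exp (-(c * (m * r))) := by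
      refine (Complex.abs_re_le_norm _).trans ?_
      rw [norm_mul]
      calc ‖F ^ m - G ^ m‖ * ‖F₁‖ ≤ ‖F ^ m - G ^ m‖ * 1 := by gcongr
        _ ≤ _ := by rw [mul_one]; exact h1
    have a2 := (Complex.abs_re_le_norm _).trans h2
    rw [add_sub_assoc]
    refine (abs_add_le _ _).trans ?_
    have := abs_add_le ((F ^ m - G ^ m) * F₁).re (G ^ m * (F₁ - 1 - l * Complex.I)).re
    linarith
  refine h5.trans ?_
  -- The error terms have the orders `r = s / m`, `m r² = s² / m` and `m² r³ = s³ / m`, which is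
  -- where the gain of `1 / m` comes from.
  set s : ℝ := m * r with hs
  have hs0 : 0 ≤ s := by positivity
  have p1 := pow_mul_exp_neg_le 1 hc hs0
  have p2 := pow_mul_exp_neg_le 2 hc hs0
  have p3 := pow_mul_exp_neg_le 3 hc hs0
  simp only [Nat.factorial, Nat.succ_eq_add_one, pow_one] at p1 p2 p3
  norm_num at p1 p2 p3
  have e : Real.exp (-(c * s)) *
        (m * (K * Real.exp (c * r₀)) * r ^ 2 + K * r + K * (m ^ 2 * r ^ 3) + m * (K * r ^ 2)) =
      (K * (s * Real.exp (-(c * s))) + A * (s ^ 2 * Real.exp (-(c * s))) +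
        K * (s ^ 3 * Real.exp (-(c * s)))) / m := by
    rw [hs, hA]; field_simp; ring
  rw [e, div_mul_eq_mul_div]
  gcongr
  have q1 := mul_le_mul_of_nonneg_left p1 hK.le
  have q2 := mul_le_mul_of_nonneg_left p2 hA0.le
  have q3 := mul_le_mul_of_nonneg_left p3 hK.le
  calc _ ≤ _ := add_le_add (add_le_add q1 q2) q3
    _ = _ := by ring

/-- The square `[-π, π]²`. -/
def square : Set (ℝ × ℝ) := Icc (-Real.pi) Real.pi ×ˢ Icc (-Real.pi) Real.pi

theorem measurableSet_square : MeasurableSet square := measurableSet_Icc.prod measurableSet_Icc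

theorem isCompact_square : IsCompact square := isCompact_Icc.prod isCompact_Icc

theorem sq_add_sq_le_of_mem_square {θ : ℝ × ℝ} (h : θ ∈ square) :
    θ.1 ^ 2 + θ.2 ^ 2 ≤ 2 * Real.pi ^ 2 := by
  obtain ⟨⟨h1, h2⟩, h3, h4⟩ := h
  nlinarith

theorem one_le_sq_add_sq_of_notMem_square {θ : ℝ × ℝ} (h : θ ∉ square) :
    1 ≤ θ.1 ^ 2 + θ.2 ^ 2 := by
  by_contra! hlt
  have hp := Real.pi_gt_three
  refine h ⟨⟨?_, ?_⟩, ?_, ?_⟩ <;> nlinarith [sq_nonneg θ.1, sq_nonneg θ.2]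

/-- The pointwise comparison is integrated: it carries a factor `1 / m`, and the integral of `e^{-m
c |θ|² / 2}` gives another. The functions `t` and `l` stand for the cubic phase of `F` and the
linear phase of `F₁`, and the bounds on them are squared so that no absolute values or roots appear.
-/
theorem exists_abs_setIntegral_re_pow_mul_sub_le {c K : ℝ} (hc : 0 < c) (hK : 0 < K) :
    ∃ C : ℝ, 0 < C ∧ ∀ (m : ℕ) (α β γ : ℝ) (t l : ℝ × ℝ → ℝ) (F F₁ : ℝ × ℝ → ℂ), 0 < m →
      Continuous F → Continuous F₁ →
      (∀ θ, c * (θ.1 ^ 2 + θ.2 ^ 2) ≤ quadForm α β γ θ) →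
      (∀ θ ∈ square, ‖F θ‖ ≤ Real.exp (-(c * (θ.1 ^ 2 + θ.2 ^ 2)))) →
      (∀ θ ∈ square, ‖F θ - Complex.exp (-(quadForm α β γ θ : ℝ) - (t θ : ℝ) * Complex.I)‖ ≤
        K * (θ.1 ^ 2 + θ.2 ^ 2) ^ 2) →
      (∀ θ ∈ square, t θ ^ 2 ≤ K * (θ.1 ^ 2 + θ.2 ^ 2) ^ 3) →
      (∀ θ ∈ square, l θ ^ 2 ≤ K * (θ.1 ^ 2 + θ.2 ^ 2)) →
      (∀ θ ∈ square, ‖F₁ θ‖ ≤ 1) →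
      (∀ θ ∈ square, ‖F₁ θ - 1 - l θ * Complex.I‖ ≤ K * (θ.1 ^ 2 + θ.2 ^ 2)) →
      |(∫ θ in square, (F θ ^ m * F₁ θ).re) - Real.pi / (m * √(α * γ - β ^ 2))| ≤
        C / (m : ℝ) ^ 2 := by
  obtain ⟨C, hC, H⟩ := exists_abs_re_pow_mul_sub_exp_le (r₀ := 2 * Real.pi ^ 2) hc hK
  set C' := max C (2 / c) with hC'
  have hC'0 : 0 < C' := lt_max_of_lt_left hC
  refine ⟨C' * (Real.pi / (c / 2)), by positivity, ?_⟩
  intro m α β γ t l F F₁ hm hFc hF1c hq hF hFG ht hl hF1 hF1l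
  have hm' : (0 : ℝ) < m := by exact_mod_cast hm
  have hmq : ∀ θ, m * quadForm α β γ θ = quadForm (m * α) (m * β) (m * γ) θ := by
    intro θ; simp only [quadForm]; ring
  have hmc : ∀ θ : ℝ × ℝ, (m * c) * (θ.1 ^ 2 + θ.2 ^ 2) ≤ quadForm (m * α) (m * β) (m * γ) θ := by
    intro θ
    rw [← hmq, mul_assoc]
    exact mul_le_mul_of_nonneg_left (hq θ) hm'.le
  have hint := integrable_exp_neg_quadForm (by positivity) hmc
  have hval := integral_exp_neg_quadForm (by positivity) hmc
  have hsq : √(m * α * (m * γ) - (m * β) ^ 2) = m * √(α * γ - β ^ 2) := by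
    rw [show (m : ℝ) * α * (m * γ) - (m * β) ^ 2 = m ^ 2 * (α * γ - β ^ 2) by ring,
      Real.sqrt_mul (by positivity), Real.sqrt_sq hm'.le]
  rw [hsq] at hval
  have hcont : Continuous fun θ => (F θ ^ m * F₁ θ).re := by fun_prop
  have hint2 : IntegrableOn (fun θ => (F θ ^ m * F₁ θ).re) square :=
    hcont.continuousOn.integrableOn_compact isCompact_square
  rw [← hval, ← integral_indicator measurableSet_square,
    ← integral_sub (hint2.integrable_indicator measurableSet_square) hint]
  have hmc2 : 0 < m * (c / 2) := by positivity
  have hg : ∀ θ : ℝ × ℝ, ‖square.indicator (fun θ => (F θ ^ m * F₁ θ).re) θ -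
      Real.exp (-quadForm (m * α) (m * β) (m * γ) θ)‖ ≤
      C' / m * Real.exp (-(m * (c / 2)) * (θ.1 ^ 2 + θ.2 ^ 2)) := by
    intro θ
    rw [Real.norm_eq_abs]
    set r := θ.1 ^ 2 + θ.2 ^ 2 with hr
    have hr0 : 0 ≤ r := by positivity
    by_cases h : θ ∈ square
    · rw [indicator_of_mem h, ← hmq]
      refine (H m r _ (t θ) (l θ) (F θ) (F₁ θ) hm hr0 (sq_add_sq_le_of_mem_square h) (hF θ h) (hq θ)
        (hFG θ h) (ht θ h) (hl θ h) (hF1 θ h) (hF1l θ h)).trans ?_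
      rw [show -(c * (m * r) / 2) = -(m * (c / 2)) * r by ring]
      gcongr
      exact le_max_left _ _
    -- Outside the square only the Gaussian is present. There `1 ≤ |θ|²`, so it may be multiplied by
    -- `|θ|²`, and it then obeys the same bound as the error inside; this accounts for the `2 / c`
    -- in `C'`.
    · rw [indicator_of_notMem h, zero_sub, abs_neg, abs_of_pos (Real.exp_pos _)]
      have h1 := one_le_sq_add_sq_of_notMem_square h
      have h2 := pow_mul_exp_neg_le 1 hc (s := m * r) (by positivity)
      simp only [Nat.factorial, pow_one] at h2
      norm_num at h2
      have h3 : m * r * Real.exp (-(c * (m * r))) ≤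
          C' * Real.exp (-(m * (c / 2)) * r) := by
        refine h2.trans ?_
        rw [show -(c * (m * r) / 2) = -(m * (c / 2)) * r by ring]
        gcongr
        exact le_max_right _ _
      calc Real.exp (-quadForm (m * α) (m * β) (m * γ) θ)
          ≤ Real.exp (-(c * (m * r))) := by
            refine Real.exp_le_exp.2 ?_
            have := hmc θ
            rw [← hr] at this
            linarith
        _ ≤ r * Real.exp (-(c * (m * r))) := le_mul_of_one_le_left (Real.exp_pos _).le h1
        _ = (m * r * Real.exp (-(c * (m * r)))) / m := by field_simp
        _ ≤ (C' * Real.exp (-(m * (c / 2)) * r)) / m := by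
            exact div_le_div_of_nonneg_right h3 hm'.le
        _ = _ := by ring
  have hfin := norm_integral_le_of_norm_le
    ((integrable_exp_neg_sq_add_sq hmc2).const_mul (C' / m))
    (Filter.Eventually.of_forall hg)
  rw [integral_const_mul, integral_exp_neg_sq_add_sq hmc2] at hfin
  refine hfin.trans (le_of_eq ?_)
  field_simp

/-! ## Trigonometric sums with nonnegative weights -/

/-- The bilinear pairing of two points of the plane. -/
def pair (θ y : ℝ × ℝ) : ℝ := θ.1 * y.1 + θ.2 * y.2

theorem pair_sq_le (θ y : ℝ × ℝ) :
    pair θ y ^ 2 ≤ (y.1 ^ 2 + y.2 ^ 2) * (θ.1 ^ 2 + θ.2 ^ 2) := by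
  unfold pair
  nlinarith [sq_nonneg (θ.1 * y.2 - θ.2 * y.1)]

/-- The characteristic function of the weights `p` placed at the points `y`. -/
def trigSum {ι : Type*} (S : Finset ι) (p : ι → ℝ) (y : ι → ℝ × ℝ) (θ : ℝ × ℝ) : ℂ :=
  ∑ i ∈ S, (p i : ℂ) * Complex.exp ((pair θ (y i) : ℝ) * Complex.I)

theorem continuous_trigSum {ι : Type*} (S : Finset ι) (p : ι → ℝ) (y : ι → ℝ × ℝ) :
    Continuous (trigSum S p y) := by
  unfold trigSum pair
  fun_prop

theorem norm_sum_mul_le {ι : Type*} {S : Finset ι} {p : ι → ℝ} {f : ι → ℂ} {M : ℝ}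
    (hp : ∀ i ∈ S, 0 ≤ p i) (hf : ∀ i ∈ S, ‖f i‖ ≤ M) :
    ‖∑ i ∈ S, (p i : ℂ) * f i‖ ≤ (∑ i ∈ S, p i) * M := by
  rw [Finset.sum_mul]
  refine (norm_sum_le _ _).trans (Finset.sum_le_sum fun i hi => ?_)
  rw [norm_mul, Complex.norm_real, Real.norm_eq_abs, abs_of_nonneg (hp i hi)]
  exact mul_le_mul_of_nonneg_left (hf i hi) (hp i hi)

theorem abs_sum_mul_le {ι : Type*} {S : Finset ι} {p f : ι → ℝ} {M : ℝ}
    (hp : ∀ i ∈ S, 0 ≤ p i) (hf : ∀ i ∈ S, |f i| ≤ M) :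
    |∑ i ∈ S, p i * f i| ≤ (∑ i ∈ S, p i) * M := by
  have h := norm_sum_mul_le (f := fun i => (f i : ℂ)) hp (M := M) (by simpa using hf)
  rw [← Real.norm_eq_abs, ← Complex.norm_real]
  simpa using h

theorem norm_trigSum_le_one {ι : Type*} {S : Finset ι} {p : ι → ℝ} (y : ι → ℝ × ℝ)
    (hp : ∀ i ∈ S, 0 ≤ p i) (h1 : ∑ i ∈ S, p i = 1) (θ : ℝ × ℝ) : ‖trigSum S p y θ‖ ≤ 1 := by
  have h := norm_sum_mul_le (f := fun i => Complex.exp ((pair θ (y i) : ℝ) * Complex.I)) hp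
    (M := 1) (fun i _ => (Complex.norm_exp_ofReal_mul_I _).le)
  rwa [h1, one_mul] at h

/-- Taylor expansion to first order, term by term. It is applied to the extra factor, whose mean
need not vanish. -/
theorem norm_sum_exp_sub_one_sub_le {ι : Type*} {S : Finset ι} {p a : ι → ℝ} {ρ : ℝ}
    (hp : ∀ i ∈ S, 0 ≤ p i) (h1 : ∑ i ∈ S, p i = 1) (ha : ∀ i ∈ S, |a i| ≤ ρ) :
    ‖(∑ i ∈ S, (p i : ℂ) * Complex.exp ((a i : ℝ) * Complex.I)) - 1 -
      (∑ i ∈ S, p i * a i : ℝ) * Complex.I‖ ≤ ρ ^ 2 * Real.exp ρ := by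
  have h1' : ∑ i ∈ S, (p i : ℂ) = 1 := by exact_mod_cast congrArg (fun x : ℝ => (x : ℂ)) h1
  have e : (∑ i ∈ S, (p i : ℂ) * Complex.exp ((a i : ℝ) * Complex.I)) - 1 -
      (∑ i ∈ S, p i * a i : ℝ) * Complex.I =
      ∑ i ∈ S, (p i : ℂ) * (Complex.exp ((a i : ℝ) * Complex.I) -
        ∑ k ∈ Finset.range 2, ((a i : ℝ) * Complex.I) ^ k / k.factorial) := by
    have hI : ∀ i, ∑ k ∈ Finset.range 2, ((a i : ℝ) * Complex.I) ^ k / k.factorial =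
        1 + (a i : ℂ) * Complex.I := by
      intro i
      simp [Finset.sum_range_succ]
    simp_rw [hI, mul_sub, Finset.sum_sub_distrib, mul_add, Finset.sum_add_distrib, ← mul_assoc,
      ← Finset.sum_mul, mul_one, h1']
    push_cast
    ring
  rw [e]
  refine (norm_sum_mul_le hp (M := ρ ^ 2 * Real.exp ρ) fun i hi => ?_).trans_eq
    (by rw [h1, one_mul])
  refine (Complex.norm_exp_sub_sum_le_norm_mul_exp _ 2).trans ?_
  rw [norm_mul, Complex.norm_I, mul_one, Complex.norm_real, Real.norm_eq_abs]
  have := ha i hi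
  gcongr

/-- With `w = -b - i t`, both sides equal `1 + w + O(ρ⁴)`: the sum by Taylor expansion to third
order, the linear term vanishing for mean zero, and `exp w` because `w = O(ρ²)`. The factors that
depend on `ρ` otherwise are bounded when `ρ` is. -/
theorem norm_sum_exp_sub_exp_le {ι : Type*} {S : Finset ι} {p a : ι → ℝ} {ρ : ℝ}
    (hp : ∀ i ∈ S, 0 ≤ p i) (h1 : ∑ i ∈ S, p i = 1) (h0 : ∑ i ∈ S, p i * a i = 0)
    (ha : ∀ i ∈ S, |a i| ≤ ρ) :
    ‖(∑ i ∈ S, (p i : ℂ) * Complex.exp ((a i : ℝ) * Complex.I)) -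
      Complex.exp (-(∑ i ∈ S, p i * (a i ^ 2 / 2) : ℝ) -
        (∑ i ∈ S, p i * (a i ^ 3 / 6) : ℝ) * Complex.I)‖ ≤
      ρ ^ 4 * (Real.exp ρ + (1 / 2 + ρ / 6) ^ 2 * Real.exp (ρ ^ 2 * (1 / 2 + ρ / 6))) := by
  have h1' : ∑ i ∈ S, (p i : ℂ) = 1 := by exact_mod_cast congrArg (fun x : ℝ => (x : ℂ)) h1
  have h0' : ∑ i ∈ S, (p i : ℂ) * (a i) = 0 := by
    exact_mod_cast congrArg (fun x : ℝ => (x : ℂ)) h0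
  set b := ∑ i ∈ S, p i * (a i ^ 2 / 2) with hb
  set t := ∑ i ∈ S, p i * (a i ^ 3 / 6) with ht
  have hbρ : |b| ≤ ρ ^ 2 / 2 := by
    refine (abs_sum_mul_le hp (M := ρ ^ 2 / 2) fun i hi => ?_).trans_eq (by rw [h1, one_mul])
    rw [abs_div, abs_pow, abs_two]
    have := ha i hi
    gcongr
  have htρ : |t| ≤ ρ ^ 3 / 6 := by
    refine (abs_sum_mul_le hp (M := ρ ^ 3 / 6) fun i hi => ?_).trans_eq (by rw [h1, one_mul])
    rw [abs_div, abs_pow, abs_of_pos (by norm_num : (0 : ℝ) < 6)]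
    have := ha i hi
    gcongr
  set w : ℂ := -(b : ℝ) - (t : ℝ) * Complex.I with hw
  have hwn : ‖w‖ ≤ ρ ^ 2 * (1 / 2 + ρ / 6) := by
    refine (norm_sub_le _ _).trans ?_
    rw [norm_neg, norm_mul, Complex.norm_I, mul_one, Complex.norm_real, Complex.norm_real,
      Real.norm_eq_abs, Real.norm_eq_abs]
    linarith
  have e1 : (∑ i ∈ S, (p i : ℂ) * Complex.exp ((a i : ℝ) * Complex.I)) - (1 + w) =
      ∑ i ∈ S, (p i : ℂ) * (Complex.exp ((a i : ℝ) * Complex.I) -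
        ∑ k ∈ Finset.range 4, ((a i : ℝ) * Complex.I) ^ k / k.factorial) := by
    have hI : ∀ i, ∑ k ∈ Finset.range 4, ((a i : ℝ) * Complex.I) ^ k / k.factorial =
        1 + (a i : ℂ) * Complex.I - (a i ^ 2 / 2 : ℂ) - (a i ^ 3 / 6 : ℂ) * Complex.I := by
      intro i
      simp only [Finset.sum_range_succ, Finset.sum_range_zero, Nat.factorial, mul_pow,
        Complex.I_sq, pow_succ Complex.I 2]
      push_cast
      ring
    simp_rw [hI, mul_sub, Finset.sum_sub_distrib, mul_add, Finset.sum_add_distrib, ← mul_assoc,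
      ← Finset.sum_mul, h0', mul_one, h1', hw, hb, ht]
    push_cast
    ring
  have n1 : ‖(∑ i ∈ S, (p i : ℂ) * Complex.exp ((a i : ℝ) * Complex.I)) - (1 + w)‖ ≤
      ρ ^ 4 * Real.exp ρ := by
    rw [e1]
    refine (norm_sum_mul_le hp (M := ρ ^ 4 * Real.exp ρ) fun i hi => ?_).trans_eq
      (by rw [h1, one_mul])
    refine (Complex.norm_exp_sub_sum_le_norm_mul_exp _ 4).trans ?_
    rw [norm_mul, Complex.norm_I, mul_one, Complex.norm_real, Real.norm_eq_abs]
    have := ha i hi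
    gcongr
  have n2 : ‖Complex.exp w - (1 + w)‖ ≤
      (ρ ^ 2 * (1 / 2 + ρ / 6)) ^ 2 * Real.exp (ρ ^ 2 * (1 / 2 + ρ / 6)) := by
    have := Complex.norm_exp_sub_sum_le_norm_mul_exp w 2
    simp only [Finset.sum_range_succ, Finset.sum_range_zero, Nat.factorial] at this
    norm_num at this
    refine this.trans ?_
    norm_num at hwn
    gcongr
  have := norm_sub_le_norm_sub_add_norm_sub
    (∑ i ∈ S, (p i : ℂ) * Complex.exp ((a i : ℝ) * Complex.I)) (1 + w) (Complex.exp w)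
  rw [norm_sub_rev (1 + w)] at this
  calc _ ≤ _ := this
    _ ≤ _ := add_le_add n1 n2
    _ = _ := by ring

/-- The squared modulus is `2 + 2 cos (a - b)`, and `cos x ≤ 1 - 2 x² / π²` on all of `[-π, π]`. -/
theorem norm_exp_add_exp_le {a b : ℝ} (h : |a - b| ≤ Real.pi) :
    ‖Complex.exp (a * Complex.I) + Complex.exp (b * Complex.I)‖ ≤ 2 - (a - b) ^ 2 / Real.pi ^ 2 := by
  have hpi := Real.pi_pos
  have hle : (a - b) ^ 2 / Real.pi ^ 2 ≤ 1 := by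
    rw [div_le_one (by positivity), sq_le_sq, abs_of_pos hpi]
    exact h
  refine le_of_sq_le_sq ?_ (by linarith)
  have e : ‖Complex.exp (a * Complex.I) + Complex.exp (b * Complex.I)‖ ^ 2 =
      2 + 2 * Real.cos (a - b) := by
    rw [← Complex.normSq_eq_norm_sq, Complex.normSq_apply]
    simp only [Complex.add_re, Complex.add_im, Complex.exp_ofReal_mul_I_re,
      Complex.exp_ofReal_mul_I_im, Real.cos_sub]
    nlinarith [Real.sin_sq_add_cos_sq a, Real.sin_sq_add_cos_sq b]
  rw [e]
  have hc := Real.cos_le_one_sub_mul_cos_sq h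
  have e2 : 2 / Real.pi ^ 2 * (a - b) ^ 2 = 2 * ((a - b) ^ 2 / Real.pi ^ 2) := by ring
  nlinarith [sq_nonneg ((a - b) ^ 2 / Real.pi ^ 2)]

/-- Four steps in two pairs, with differences `(0, 1)` and `(1, 0)`. -/
def fourSteps : Finset (ℤ × ℤ) := {(1, 0), (1, -1), (0, 1), (-1, 1)}

theorem sum_fourSteps {M : Type*} [AddCommMonoid M] (f : ℤ × ℤ → M) :
    ∑ v ∈ fourSteps, f v = f (1, 0) + (f (1, -1) + (f (0, 1) + f (-1, 1))) := by
  unfold fourSteps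
  rw [Finset.sum_insert (by decide), Finset.sum_insert (by decide), Finset.sum_insert (by decide),
    Finset.sum_singleton]

/-- The displacement `v - δ`. -/
def shift (δ : ℝ × ℝ) (v : ℤ × ℤ) : ℝ × ℝ := (v.1 - δ.1, v.2 - δ.2)

/-- Mass `c₀` is split off from each of the four steps and the rest is bounded by its total mass `1
- 4 c₀`. Within each of the two pairs the phases differ by a coordinate of `θ`, whatever `δ` is, so
the pairs lose `c₀ |θ|² / π²`. The bound holds on the whole square, so frequencies far from zero
need no separate aperiodicity argument. -/
theorem norm_trigSum_shift_le {S : Finset (ℤ × ℤ)} {p : ℤ × ℤ → ℝ} {c₀ : ℝ} (δ : ℝ × ℝ)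
    (hS : fourSteps ⊆ S) (hc₀ : 0 ≤ c₀) (hp : ∀ i ∈ S, 0 ≤ p i) (h1 : ∑ i ∈ S, p i = 1)
    (h4 : ∀ i ∈ fourSteps, c₀ ≤ p i) {θ : ℝ × ℝ} (hθ : θ ∈ square) :
    ‖trigSum S p (shift δ) θ‖ ≤ Real.exp (-(c₀ / Real.pi ^ 2 * (θ.1 ^ 2 + θ.2 ^ 2))) := by
  set f : ℤ × ℤ → ℂ := fun v => Complex.exp ((pair θ (shift δ v) : ℝ) * Complex.I) with hf
  set q : ℤ × ℤ → ℝ := fun v => if v ∈ fourSteps then c₀ else 0 with hq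
  have hqsum : ∀ g : ℤ × ℤ → ℂ, ∑ v ∈ S, (q v : ℂ) * g v = ∑ v ∈ fourSteps, (c₀ : ℂ) * g v := by
    intro g
    rw [← Finset.sum_subset hS]
    · exact Finset.sum_congr rfl fun v hv => by simp [hq, hv]
    · intro v _ hv
      simp [hq, hv]
  have hqsum1 : ∑ v ∈ S, q v = 4 * c₀ := by
    have := hqsum fun _ => 1
    rw [sum_fourSteps] at this
    have h2 : ((∑ v ∈ S, q v : ℝ) : ℂ) = (4 * c₀ : ℝ) := by
      push_cast
      simp only [mul_one] at this
      rw [this]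
      ring
    exact_mod_cast h2
  have hsplit : trigSum S p (shift δ) θ =
      ∑ v ∈ S, ((p v - q v : ℝ) : ℂ) * f v + ∑ v ∈ fourSteps, (c₀ : ℂ) * f v := by
    rw [← hqsum, ← Finset.sum_add_distrib]
    refine Finset.sum_congr rfl fun v _ => ?_
    push_cast
    ring
  have n1 : ‖∑ v ∈ S, ((p v - q v : ℝ) : ℂ) * f v‖ ≤ 1 - 4 * c₀ := by
    refine (norm_sum_mul_le (p := fun v => p v - q v) (M := 1) (fun v hv => ?_)
      (fun v _ => (Complex.norm_exp_ofReal_mul_I _).le)).trans_eq ?_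
    · simp only [hq, sub_nonneg]
      split_ifs with h
      · exact h4 v h
      · exact hp v hv
    · rw [Finset.sum_sub_distrib, h1, hqsum1, mul_one]
  obtain ⟨⟨b1, b2⟩, b3, b4⟩ := hθ
  have d1 : pair θ (shift δ (1, 0)) - pair θ (shift δ (1, -1)) = θ.2 := by
    simp [pair, shift]; ring
  have d2 : pair θ (shift δ (0, 1)) - pair θ (shift δ (-1, 1)) = θ.1 := by
    simp [pair, shift]; ring
  have m1 : ‖f (1, 0) + f (1, -1)‖ ≤ 2 - θ.2 ^ 2 / Real.pi ^ 2 := by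
    have := norm_exp_add_exp_le (a := pair θ (shift δ (1, 0))) (b := pair θ (shift δ (1, -1)))
      (by rw [d1]; exact abs_le.2 ⟨b3, b4⟩)
    rwa [d1] at this
  have m2 : ‖f (0, 1) + f (-1, 1)‖ ≤ 2 - θ.1 ^ 2 / Real.pi ^ 2 := by
    have := norm_exp_add_exp_le (a := pair θ (shift δ (0, 1))) (b := pair θ (shift δ (-1, 1)))
      (by rw [d2]; exact abs_le.2 ⟨b1, b2⟩)
    rwa [d2] at this
  have n2 : ‖∑ v ∈ fourSteps, (c₀ : ℂ) * f v‖ ≤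
      c₀ * ((2 - θ.2 ^ 2 / Real.pi ^ 2) + (2 - θ.1 ^ 2 / Real.pi ^ 2)) := by
    rw [← Finset.mul_sum, norm_mul, Complex.norm_real, Real.norm_eq_abs, abs_of_nonneg hc₀,
      sum_fourSteps, ← add_assoc]
    gcongr
    exact (norm_add_le _ _).trans (add_le_add m1 m2)
  rw [hsplit]
  refine (norm_add_le _ _).trans ((add_le_add n1 n2).trans ?_)
  have := Real.add_one_le_exp (-(c₀ / Real.pi ^ 2 * (θ.1 ^ 2 + θ.2 ^ 2)))
  refine le_trans (le_of_eq ?_) this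
  ring

/-- By `x² + y² ≥ (x - y)² / 2` within each pair of steps, where the difference is a coordinate of
`θ` and no longer involves `δ`. -/
theorem le_sum_mul_pair_shift_sq {S : Finset (ℤ × ℤ)} {p : ℤ × ℤ → ℝ} {c₀ : ℝ} (δ : ℝ × ℝ)
    (hS : fourSteps ⊆ S) (hc₀ : 0 ≤ c₀) (hp : ∀ i ∈ S, 0 ≤ p i)
    (h4 : ∀ i ∈ fourSteps, c₀ ≤ p i) (θ : ℝ × ℝ) :
    c₀ / 4 * (θ.1 ^ 2 + θ.2 ^ 2) ≤ ∑ v ∈ S, p v * (pair θ (shift δ v) ^ 2 / 2) := by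
  have h : ∑ v ∈ fourSteps, c₀ * (pair θ (shift δ v) ^ 2 / 2) ≤
      ∑ v ∈ S, p v * (pair θ (shift δ v) ^ 2 / 2) := by
    refine (Finset.sum_le_sum fun v hv => ?_).trans (Finset.sum_le_sum_of_subset_of_nonneg hS
      fun v hv _ => mul_nonneg (hp v hv) (by positivity))
    exact mul_le_mul_of_nonneg_right (h4 v hv) (by positivity)
  refine le_trans ?_ h
  rw [sum_fourSteps]
  simp only [pair, shift]
  push_cast
  have e : ∀ x y : ℝ, (x - y) ^ 2 ≤ 2 * x ^ 2 + 2 * y ^ 2 := fun x y => by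
    nlinarith [sq_nonneg (x + y)]
  have e1 := e (θ.1 * (1 - δ.1) + θ.2 * (0 - δ.2)) (θ.1 * (1 - δ.1) + θ.2 * (-1 - δ.2))
  have e2 := e (θ.1 * (0 - δ.1) + θ.2 * (1 - δ.2)) (θ.1 * (-1 - δ.1) + θ.2 * (1 - δ.2))
  ring_nf at e1 e2 ⊢
  nlinarith

/-- The entries of the covariance form of the weights `p`, for the mean `δ`. -/
def covXX (S : Finset (ℤ × ℤ)) (p : ℤ × ℤ → ℝ) (δ : ℝ × ℝ) : ℝ := ∑ v ∈ S, p v * (v.1 - δ.1) ^ 2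

/-- See `covXX`. -/
def covXY (S : Finset (ℤ × ℤ)) (p : ℤ × ℤ → ℝ) (δ : ℝ × ℝ) : ℝ :=
  ∑ v ∈ S, p v * ((v.1 - δ.1) * (v.2 - δ.2))

/-- See `covXX`. -/
def covYY (S : Finset (ℤ × ℤ)) (p : ℤ × ℤ → ℝ) (δ : ℝ × ℝ) : ℝ := ∑ v ∈ S, p v * (v.2 - δ.2) ^ 2

/-- The determinant of the covariance matrix. -/
def covDet (S : Finset (ℤ × ℤ)) (p : ℤ × ℤ → ℝ) (δ : ℝ × ℝ) : ℝ :=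
  covXX S p δ * covYY S p δ - covXY S p δ ^ 2

theorem quadForm_cov (S : Finset (ℤ × ℤ)) (p : ℤ × ℤ → ℝ) (δ θ : ℝ × ℝ) :
    quadForm (covXX S p δ / 2) (covXY S p δ / 2) (covYY S p δ / 2) θ =
      ∑ v ∈ S, p v * (pair θ (shift δ v) ^ 2 / 2) := by
  simp only [quadForm, covXX, covXY, covYY, Finset.sum_div, Finset.sum_mul, Finset.mul_sum,
    ← Finset.sum_add_distrib]
  refine Finset.sum_congr rfl fun v _ => ?_
  simp only [pair, shift]
  ring

theorem sq_le_covDet {S : Finset (ℤ × ℤ)} {p : ℤ × ℤ → ℝ} {c₀ : ℝ} (δ : ℝ × ℝ)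
    (hS : fourSteps ⊆ S) (hc₀ : 0 < c₀) (hp : ∀ i ∈ S, 0 ≤ p i)
    (h4 : ∀ i ∈ fourSteps, c₀ ≤ p i) : (c₀ / 2) ^ 2 ≤ covDet S p δ := by
  have h := (quadForm_coercive (c := c₀ / 4) (by positivity) fun θ => by
    rw [quadForm_cov]; exact le_sum_mul_pair_shift_sq δ hS hc₀.le hp h4 θ).2
  unfold covDet
  linarith

/-- Local limit theorem for weights with exact mean `δ`, with a modified factor. -/
theorem exists_abs_setIntegral_trigSum_sub_le {c₀ M : ℝ} (hc₀ : 0 < c₀) (hM : 0 < M) :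
    ∃ C : ℝ, 0 < C ∧ ∀ (m : ℕ) (S T : Finset (ℤ × ℤ)) (p q : ℤ × ℤ → ℝ) (δ : ℝ × ℝ)
      (y : ℤ × ℤ → ℝ × ℝ), 0 < m → fourSteps ⊆ S → (∀ i ∈ S, 0 ≤ p i) → ∑ i ∈ S, p i = 1 →
      (∀ i ∈ fourSteps, c₀ ≤ p i) → ∑ i ∈ S, p i * i.1 = δ.1 → ∑ i ∈ S, p i * i.2 = δ.2 →
      (∀ i ∈ S, (shift δ i).1 ^ 2 + (shift δ i).2 ^ 2 ≤ M) →
      (∀ i ∈ T, 0 ≤ q i) → ∑ i ∈ T, q i = 1 → (∀ i ∈ T, (y i).1 ^ 2 + (y i).2 ^ 2 ≤ M) →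
      |(∫ θ in square, (trigSum S p (shift δ) θ ^ m * trigSum T q y θ).re) -
        2 * Real.pi / (m * √(covDet S p δ))| ≤ C / (m : ℝ) ^ 2 := by
  set ρ₀ : ℝ := √(M * (2 * Real.pi ^ 2)) with hρ₀
  set K₁ : ℝ := M ^ 2 * (Real.exp ρ₀ + (1 / 2 + ρ₀ / 6) ^ 2 *
    Real.exp (ρ₀ ^ 2 * (1 / 2 + ρ₀ / 6))) with hK₁
  set K₂ : ℝ := M * Real.exp ρ₀ with hK₂
  have hρ₀0 : 0 ≤ ρ₀ := Real.sqrt_nonneg _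
  have hK₁0 : 0 < K₁ := by positivity
  have hK₂0 : 0 < K₂ := by positivity
  -- The four summands serve, in order, the expansion of the centred factor, the expansion of the
  -- extra factor, the linear phase and the cubic phase.
  set K := K₁ + K₂ + M + M ^ 3 with hK
  have hM3 : 0 < M ^ 3 := by positivity
  have hpi := Real.pi_gt_three
  obtain ⟨C, hC, H⟩ := exists_abs_setIntegral_re_pow_mul_sub_le (c := c₀ / Real.pi ^ 2) (K := K)
    (by positivity) (by positivity)
  refine ⟨C, hC, fun m S T p q δ y hm hS hp h1 h4 hδ1 hδ2 hSM hq hq1 hTM => ?_⟩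
  -- The exponent of the Gaussian is half the variance, so the root of its determinant is `√(covDet
  -- S p δ) / 2`; this turns `π` into `2π` in the main term.
  have hD : √(covXX S p δ / 2 * (covYY S p δ / 2) - (covXY S p δ / 2) ^ 2) =
      √(covDet S p δ) / 2 := by
    rw [show covXX S p δ / 2 * (covYY S p δ / 2) - (covXY S p δ / 2) ^ 2 = covDet S p δ / 2 ^ 2 by
      unfold covDet; ring, Real.sqrt_div' _ (by positivity), Real.sqrt_sq (by positivity)]
  have hpair : ∀ {z θ : ℝ × ℝ}, z.1 ^ 2 + z.2 ^ 2 ≤ M →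
      |pair θ z| ≤ √(M * (θ.1 ^ 2 + θ.2 ^ 2)) := fun {z θ} hz => by
    refine Real.abs_le_sqrt ((pair_sq_le θ z).trans ?_)
    gcongr
  have hle : ∀ {θ : ℝ × ℝ}, θ ∈ square → √(M * (θ.1 ^ 2 + θ.2 ^ 2)) ≤ ρ₀ := fun {θ} hθ => by
    refine Real.sqrt_le_sqrt ?_
    gcongr
    exact sq_add_sq_le_of_mem_square hθ
  have hrho : ∀ θ : ℝ × ℝ, √(M * (θ.1 ^ 2 + θ.2 ^ 2)) ^ 2 = M * (θ.1 ^ 2 + θ.2 ^ 2) := fun θ =>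
    Real.sq_sqrt (by positivity)
  have := H m (covXX S p δ / 2) (covXY S p δ / 2) (covYY S p δ / 2)
    (fun θ => ∑ v ∈ S, p v * (pair θ (shift δ v) ^ 3 / 6))
    (fun θ => ∑ i ∈ T, q i * pair θ (y i)) (trigSum S p (shift δ)) (trigSum T q y) hm
    (continuous_trigSum _ _ _) (continuous_trigSum _ _ _) (fun θ => ?_)
    (fun θ hθ => norm_trigSum_shift_le δ hS hc₀.le hp h1 h4 hθ)
    (fun θ hθ => ?_) (fun θ hθ => ?_) (fun θ hθ => ?_)
    (fun θ _ => norm_trigSum_le_one y hq hq1 θ) (fun θ hθ => ?_)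
  rotate_left
  -- The available constant `c₀ / 4` exceeds the required `c₀ / π²`, since `π > 3`.
  · rw [quadForm_cov]
    refine le_trans ?_ (le_sum_mul_pair_shift_sq δ hS hc₀.le hp h4 θ)
    gcongr
    nlinarith
  · rw [quadForm_cov]
    refine (norm_sum_exp_sub_exp_le hp h1 ?_
      fun i hi => hpair (θ := θ) (hSM i hi)).trans ?_
    · have e : ∀ v : ℤ × ℤ, p v * pair θ (shift δ v) =
          θ.1 * (p v * v.1) + θ.2 * (p v * v.2) - pair θ δ * p v := fun v => by
        simp only [pair, shift]; ring
      simp_rw [e, Finset.sum_sub_distrib, Finset.sum_add_distrib, ← Finset.mul_sum, h1, hδ1, hδ2]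
      simp only [pair]; ring
    · have hl := hle hθ
      have : √(M * (θ.1 ^ 2 + θ.2 ^ 2)) ^ 4 = M ^ 2 * (θ.1 ^ 2 + θ.2 ^ 2) ^ 2 := by
        rw [show (4 : ℕ) = 2 * 2 from rfl, pow_mul, hrho]; ring
      rw [this]
      calc _ ≤ M ^ 2 * (θ.1 ^ 2 + θ.2 ^ 2) ^ 2 * (Real.exp ρ₀ + (1 / 2 + ρ₀ / 6) ^ 2 *
              Real.exp (ρ₀ ^ 2 * (1 / 2 + ρ₀ / 6))) := by gcongr
        _ = K₁ * (θ.1 ^ 2 + θ.2 ^ 2) ^ 2 := by rw [hK₁]; ring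
        _ ≤ _ := by gcongr; rw [hK]; linarith
  · have hb := abs_sum_mul_le (p := p) (f := fun v => pair θ (shift δ v) ^ 3 / 6)
      (M := √(M * (θ.1 ^ 2 + θ.2 ^ 2)) ^ 3) hp (fun i hi => by
        rw [abs_div, abs_pow, abs_of_pos (by norm_num : (0 : ℝ) < 6)]
        have h3 : |pair θ (shift δ i)| ^ 3 ≤ √(M * (θ.1 ^ 2 + θ.2 ^ 2)) ^ 3 :=
          pow_le_pow_left₀ (abs_nonneg _) (hpair (hSM i hi)) 3
        have : 0 ≤ |pair θ (shift δ i)| ^ 3 := by positivity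
        linarith)
    rw [h1, one_mul] at hb
    calc _ ≤ (√(M * (θ.1 ^ 2 + θ.2 ^ 2)) ^ 3) ^ 2 := by
          rw [sq_le_sq, abs_of_nonneg (a := √(M * (θ.1 ^ 2 + θ.2 ^ 2)) ^ 3) (by positivity)]
          exact hb
      _ = M ^ 3 * (θ.1 ^ 2 + θ.2 ^ 2) ^ 3 := by rw [← pow_mul, mul_comm 3 2, pow_mul, hrho]; ring
      _ ≤ _ := by gcongr; rw [hK]; linarith
  · have hb := abs_sum_mul_le (p := q) (f := fun v => pair θ (y v))
      (M := √(M * (θ.1 ^ 2 + θ.2 ^ 2))) hq (fun i hi => hpair (hTM i hi))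
    rw [hq1, one_mul] at hb
    calc _ ≤ √(M * (θ.1 ^ 2 + θ.2 ^ 2)) ^ 2 := by
          rw [sq_le_sq, abs_of_nonneg (a := √(M * (θ.1 ^ 2 + θ.2 ^ 2))) (by positivity)]
          exact hb
      _ = M * (θ.1 ^ 2 + θ.2 ^ 2) := hrho θ
      _ ≤ _ := by gcongr; rw [hK]; linarith
  · refine (norm_sum_exp_sub_one_sub_le hq hq1 fun i hi => hpair (θ := θ) (hTM i hi)).trans ?_
    have hl := hle hθ
    rw [hrho]
    calc _ ≤ M * (θ.1 ^ 2 + θ.2 ^ 2) * Real.exp ρ₀ := by gcongr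
      _ = K₂ * (θ.1 ^ 2 + θ.2 ^ 2) := by rw [hK₂]; ring
      _ ≤ _ := by gcongr; rw [hK]; linarith
  · rw [hD] at this
    convert this using 3
    rw [mul_div_assoc', div_div_eq_mul_div]
    ring

/-! ## Fourier inversion on `ℤ²` -/

theorem integral_exp_neg_int_mul_I (k : ℤ) :
    ∫ x in Icc (-Real.pi) Real.pi, Complex.exp (-((x * k : ℝ) * Complex.I)) =
      if k = 0 then 2 * (Real.pi : ℂ) else 0 := by
  rw [integral_Icc_eq_integral_Ioc,
    ← intervalIntegral.integral_of_le (by linarith [Real.pi_pos])]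
  split_ifs with h
  · subst h
    simp
    ring
  · have hk : -(k * Complex.I) ≠ 0 := by
      simp [h, Complex.I_ne_zero]
    have e : ∀ x : ℝ, Complex.exp (-((x * k : ℝ) * Complex.I)) =
        Complex.exp (-(k * Complex.I) * x) := fun x => by
      congr 1; push_cast; ring
    simp_rw [e]
    rw [integral_exp_mul_complex hk]
    have e2 : Complex.exp (-(k * Complex.I) * (Real.pi : ℝ)) =
        Complex.exp (-(k * Complex.I) * (-Real.pi : ℝ)) := by
      rw [Complex.exp_eq_exp_iff_exists_int]
      exact ⟨-k, by push_cast; ring⟩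
    rw [e2, sub_self, zero_div]

theorem setIntegral_exp_neg_pair (k : ℤ × ℤ) :
    ∫ θ in square, Complex.exp (-((pair θ (shift 0 k) : ℝ) * Complex.I)) =
      if k = 0 then (2 * (Real.pi : ℂ)) ^ 2 else 0 := by
  have e : ∀ θ : ℝ × ℝ, Complex.exp (-((pair θ (shift 0 k) : ℝ) * Complex.I)) =
      Complex.exp (-((θ.1 * k.1 : ℝ) * Complex.I)) *
        Complex.exp (-((θ.2 * k.2 : ℝ) * Complex.I)) := fun θ => by
    rw [← Complex.exp_add]
    congr 1
    simp only [pair, shift, Prod.fst_zero, Prod.snd_zero]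
    push_cast
    ring
  simp_rw [e]
  rw [square, Measure.volume_eq_prod, setIntegral_prod_mul
    (fun x : ℝ => Complex.exp (-((x * k.1 : ℝ) * Complex.I)))
    (fun x : ℝ => Complex.exp (-((x * k.2 : ℝ) * Complex.I))),
    integral_exp_neg_int_mul_I, integral_exp_neg_int_mul_I]
  have hk : k = 0 ↔ k.1 = 0 ∧ k.2 = 0 := Prod.ext_iff
  by_cases h1 : k.1 = 0 <;> by_cases h2 : k.2 = 0 <;> simp [hk, h1, h2]
  ring

/-- `a n x` is the `n`-th convolution power, at `x`, of the weights `w` on the finite set `S`. -/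
structure IsConvPow (S : Finset (ℤ × ℤ)) (w : ℤ × ℤ → ℝ) (a : ℕ → ℤ × ℤ → ℝ) : Prop where
  zero : ∀ x, a 0 x = if x = 0 then 1 else 0
  succ : ∀ n x, a (n + 1) x = ∑ v ∈ S, w v * a n (x - v)

theorem trigSum_mul_exp_neg_pair (S : Finset (ℤ × ℤ)) (p : ℤ × ℤ → ℝ) (θ : ℝ × ℝ) (x : ℤ × ℤ) :
    trigSum S p (shift 0) θ * Complex.exp (-((pair θ (shift 0 x) : ℝ) * Complex.I)) =
      ∑ v ∈ S, (p v : ℂ) * Complex.exp (-((pair θ (shift 0 (x - v)) : ℝ) * Complex.I)) := by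
  rw [trigSum, Finset.sum_mul]
  refine Finset.sum_congr rfl fun v _ => ?_
  rw [mul_assoc, ← Complex.exp_add]
  congr 2
  simp only [pair, shift, Prod.fst_zero, Prod.snd_zero, Prod.fst_sub, Prod.snd_sub]
  push_cast
  ring

theorem setIntegral_trigSum_mul {g : ℝ × ℝ → ℂ} (hg : Continuous g) (S : Finset (ℤ × ℤ))
    (p : ℤ × ℤ → ℝ) (x : ℤ × ℤ) :
    ∫ θ in square, g θ * (trigSum S p (shift 0) θ *
        Complex.exp (-((pair θ (shift 0 x) : ℝ) * Complex.I))) =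
      ∑ v ∈ S, (p v : ℂ) * ∫ θ in square, g θ *
        Complex.exp (-((pair θ (shift 0 (x - v)) : ℝ) * Complex.I)) := by
  simp_rw [trigSum_mul_exp_neg_pair, Finset.mul_sum, mul_left_comm (g _)]
  rw [integral_finsetSum]
  · exact Finset.sum_congr rfl fun v _ => integral_const_mul _ _
  · intro v _
    refine ContinuousOn.integrableOn_compact isCompact_square (Continuous.continuousOn ?_)
    unfold pair
    fun_prop

/-- Induction on `n`: one more factor of the characteristic function translates the exponential by
the steps, which is the convolution recursion. Only orthogonality of the exponentials at `n = 0` is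
needed, and no infinite series occurs. -/
theorem IsConvPow.eq_setIntegral {S : Finset (ℤ × ℤ)} {p : ℤ × ℤ → ℝ} {a : ℕ → ℤ × ℤ → ℝ}
    (h : IsConvPow S p a) (n : ℕ) (x : ℤ × ℤ) :
    (2 * (Real.pi : ℂ)) ^ 2 * a n x = ∫ θ in square, trigSum S p (shift 0) θ ^ n *
      Complex.exp (-((pair θ (shift 0 x) : ℝ) * Complex.I)) := by
  induction n generalizing x with
  | zero =>
    simp only [pow_zero, one_mul]
    rw [setIntegral_exp_neg_pair, h.zero]
    split_ifs <;> simp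
  | succ n ih =>
    simp_rw [pow_succ (trigSum S p (shift 0) _), mul_assoc]
    rw [setIntegral_trigSum_mul (g := fun θ => trigSum S p (shift 0) θ ^ n)
      ((continuous_trigSum _ _ _).pow n), h.succ]
    simp_rw [← ih]
    push_cast
    rw [Finset.mul_sum]
    exact Finset.sum_congr rfl fun v _ => by ring

theorem trigSum_shift (S : Finset (ℤ × ℤ)) (p : ℤ × ℤ → ℝ) (δ θ : ℝ × ℝ) :
    trigSum S p (shift δ) θ =
      trigSum S p (shift 0) θ * Complex.exp (-((pair θ δ : ℝ) * Complex.I)) := by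
  rw [trigSum, trigSum, Finset.sum_mul]
  refine Finset.sum_congr rfl fun v _ => ?_
  rw [mul_assoc, ← Complex.exp_add]
  congr 2
  simp only [pair, shift, Prod.fst_zero, Prod.snd_zero]
  push_cast
  ring

/-- The phase `e^{-i⟨θ,x⟩}` is distributed as `n` copies of `e^{-i⟨θ,δ⟩}`, which centre the `n`
factors, and a remainder `e^{-i⟨θ,x - nδ⟩}`, which goes into the factor of `T`. That factor
represents a final step different from the others. Real parts may be taken because the left side is
real. -/
theorem IsConvPow.sum_eq_setIntegral {S : Finset (ℤ × ℤ)} {p : ℤ × ℤ → ℝ} {a : ℕ → ℤ × ℤ → ℝ}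
    (h : IsConvPow S p a) (n : ℕ) (x : ℤ × ℤ) (T : Finset (ℤ × ℤ)) (q : ℤ × ℤ → ℝ) (δ : ℝ × ℝ) :
    (2 * Real.pi) ^ 2 * ∑ s ∈ T, q s * a n (x - s) =
      ∫ θ in square, (trigSum S p (shift δ) θ ^ n *
        trigSum T q (shift (x.1 - n * δ.1, x.2 - n * δ.2)) θ).re := by
  have e : ∀ θ : ℝ × ℝ, trigSum S p (shift δ) θ ^ n *
        trigSum T q (shift (x.1 - n * δ.1, x.2 - n * δ.2)) θ =
      trigSum S p (shift 0) θ ^ n * (trigSum T q (shift 0) θ *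
        Complex.exp (-((pair θ (shift 0 x) : ℝ) * Complex.I))) := by
    intro θ
    rw [trigSum_shift S, trigSum_shift T, mul_pow, ← Complex.exp_nat_mul]
    have : Complex.exp (-((pair θ (shift 0 x) : ℝ) * Complex.I)) =
        Complex.exp (n * -((pair θ δ : ℝ) * Complex.I)) *
        Complex.exp (-((pair θ (x.1 - n * δ.1, x.2 - n * δ.2) : ℝ) * Complex.I)) := by
      rw [← Complex.exp_add]
      congr 1
      simp only [pair, shift, Prod.fst_zero, Prod.snd_zero]
      push_cast
      ring
    rw [this]
    ring
  have hc : Continuous fun θ => trigSum S p (shift δ) θ ^ n *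
        trigSum T q (shift (x.1 - n * δ.1, x.2 - n * δ.2)) θ :=
    ((continuous_trigSum _ _ _).pow n).mul (continuous_trigSum _ _ _)
  have hre := integral_re (hc.continuousOn.integrableOn_compact (μ := volume) isCompact_square)
  simp only [RCLike.re_to_complex] at hre
  rw [hre]
  simp_rw [e]
  rw [setIntegral_trigSum_mul (g := fun θ => trigSum S p (shift 0) θ ^ n)
    ((continuous_trigSum _ _ _).pow n)]
  simp_rw [← h.eq_setIntegral]
  have : ∑ v ∈ T, (q v : ℂ) * ((2 * (Real.pi : ℂ)) ^ 2 * (a n (x - v) : ℂ)) =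
      (((2 * Real.pi) ^ 2 * ∑ s ∈ T, q s * a n (x - s) : ℝ) : ℂ) := by
    push_cast
    rw [Finset.mul_sum]
    exact Finset.sum_congr rfl fun v _ => by ring
  rw [this, Complex.ofReal_re]

/-! ## Exponential tilting -/

/-- The exponential generating function of the weights `w` on `S`. -/
def expSum (S : Finset (ℤ × ℤ)) (w : ℤ × ℤ → ℝ) (u : ℝ × ℝ) : ℝ :=
  ∑ v ∈ S, w v * Real.exp (pair u (shift 0 v))

/-- The tilted weights. -/
def tilt (S : Finset (ℤ × ℤ)) (w : ℤ × ℤ → ℝ) (u : ℝ × ℝ) (v : ℤ × ℤ) : ℝ :=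
  w v * Real.exp (pair u (shift 0 v)) / expSum S w u

theorem tilt_nonneg {S : Finset (ℤ × ℤ)} {w : ℤ × ℤ → ℝ} {u : ℝ × ℝ} (hw : ∀ v ∈ S, 0 ≤ w v)
    (h0 : 0 < expSum S w u) : ∀ v ∈ S, 0 ≤ tilt S w u v := fun v hv =>
  div_nonneg (mul_nonneg (hw v hv) (Real.exp_pos _).le) h0.le

theorem sum_tilt {S : Finset (ℤ × ℤ)} {w : ℤ × ℤ → ℝ} {u : ℝ × ℝ} (h0 : 0 < expSum S w u) :
    ∑ v ∈ S, tilt S w u v = 1 := by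
  simp only [tilt]
  rw [← Finset.sum_div]
  exact div_self h0.ne'

theorem exp_pair_shift_sub (u : ℝ × ℝ) (x v : ℤ × ℤ) :
    Real.exp (pair u (shift 0 x)) =
      Real.exp (pair u (shift 0 v)) * Real.exp (pair u (shift 0 (x - v))) := by
  rw [← Real.exp_add]
  congr 1
  simp only [pair, shift, Prod.fst_zero, Prod.snd_zero, Prod.fst_sub, Prod.snd_sub]
  push_cast
  ring

theorem IsConvPow.tilt {S : Finset (ℤ × ℤ)} {w : ℤ × ℤ → ℝ} {a : ℕ → ℤ × ℤ → ℝ}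
    (h : IsConvPow S w a) {u : ℝ × ℝ} (h0 : 0 < expSum S w u) :
    IsConvPow S (tilt S w u)
      (fun n x => a n x * Real.exp (pair u (shift 0 x)) / expSum S w u ^ n) where
  zero x := by
    rw [h.zero]
    split_ifs with hx
    · subst hx
      simp [pair, shift]
    · simp
  succ n x := by
    rw [h.succ, Finset.sum_mul, Finset.sum_div]
    refine Finset.sum_congr rfl fun v _ => ?_
    rw [exp_pair_shift_sub u x v, LatticeWalk.tilt]
    field_simp
    ring

/-- The value of a mixture of convolution powers as an integral of tilted characteristic
functions. -/
theorem IsConvPow.sum_eq_tilt {S T : Finset (ℤ × ℤ)} {w g : ℤ × ℤ → ℝ} {a : ℕ → ℤ × ℤ → ℝ}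
    (h : IsConvPow S w a) {u : ℝ × ℝ} (hS : 0 < expSum S w u) (hT : 0 < expSum T g u)
    (n : ℕ) (x : ℤ × ℤ) (δ : ℝ × ℝ) :
    ∑ s ∈ T, g s * a n (x - s) =
      Real.exp (-pair u (shift 0 x)) * expSum S w u ^ n * expSum T g u *
        ((∫ θ in square, (trigSum S (LatticeWalk.tilt S w u) (shift δ) θ ^ n *
        trigSum T (LatticeWalk.tilt T g u) (shift (x.1 - n * δ.1, x.2 - n * δ.2)) θ).re) /
          (2 * Real.pi) ^ 2) := by
  rw [← (h.tilt hS).sum_eq_setIntegral n x T (LatticeWalk.tilt T g u) δ,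
    mul_div_cancel_left₀ _ (by positivity), Finset.mul_sum]
  refine Finset.sum_congr rfl fun s _ => ?_
  rw [exp_pair_shift_sub (-u) x s |> fun e => (by
    have : -pair u (shift 0 x) = pair (-u) (shift 0 x) := by simp [pair]; ring
    rw [this, e] : Real.exp (-pair u (shift 0 x)) = _)]
  have e1 : pair (-u) (shift 0 s) = -pair u (shift 0 s) := by simp [pair]; ring
  have e2 : pair (-u) (shift 0 (x - s)) = -pair u (shift 0 (x - s)) := by simp [pair]; ring
  rw [e1, e2, Real.exp_neg, Real.exp_neg, LatticeWalk.tilt]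
  field_simp

/-! ## Laws on the six steps with a holding probability -/

/-- The law with mass `a` at `0` and `b` at each of the six steps. -/
def sixLaw (a b : ℝ) (v : ℤ × ℤ) : ℝ := if v = 0 then a else if v ∈ sixSteps then b else 0

theorem triLaw_eq_sixLaw : triLaw = sixLaw 0 (1 / 6) := by
  funext v
  unfold triLaw sixLaw
  by_cases h : v = 0
  · subst h
    rw [if_pos rfl, if_neg (by decide)]
  · rw [if_neg h]

theorem hexTwoStepLaw_eq_sixLaw : hexTwoStepLaw = sixLaw (1 / 3) (1 / 9) := rfl

/-- The origin and the six steps. -/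
def sevenSteps : Finset (ℤ × ℤ) := insert 0 sixSteps

theorem fourSteps_subset_sixSteps : fourSteps ⊆ sixSteps := by decide

theorem sixSteps_subset_sevenSteps : sixSteps ⊆ sevenSteps := Finset.subset_insert _ _

theorem fourSteps_subset_sevenSteps : fourSteps ⊆ sevenSteps :=
  fourSteps_subset_sixSteps.trans sixSteps_subset_sevenSteps

theorem sum_sixLaw_mul {M : Type*} [AddCommMonoid M] [Module ℝ M] (a b : ℝ) (f : ℤ × ℤ → M) :
    ∑ v ∈ sevenSteps, sixLaw a b v • f v = a • f 0 + b • (f (1, 0) + (f (-1, 0) + (f (0, 1) +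
      (f (0, -1) + (f (1, -1) + f (-1, 1)))))) := by
  unfold sevenSteps
  rw [Finset.sum_insert (by decide)]
  have h : ∑ v ∈ sixSteps, sixLaw a b v • f v = ∑ v ∈ sixSteps, b • f v := by
    refine Finset.sum_congr rfl fun v hv => ?_
    have h0 : v ≠ 0 := by rintro rfl; revert hv; decide
    rw [sixLaw, if_neg h0, if_pos hv]
  rw [h, ← Finset.smul_sum]
  unfold sixSteps
  rw [Finset.sum_insert (by decide), Finset.sum_insert (by decide), Finset.sum_insert (by decide),
    Finset.sum_insert (by decide), Finset.sum_insert (by decide), Finset.sum_singleton]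
  simp [sixLaw]

/-- The hypotheses on the two masses of a `sixLaw`. -/
structure IsLazy (a b : ℝ) : Prop where
  nonneg : 0 ≤ a
  pos : 0 < b
  total : a + 6 * b = 1

theorem IsLazy.law_nonneg {a b : ℝ} (h : IsLazy a b) (v : ℤ × ℤ) : 0 ≤ sixLaw a b v := by
  unfold sixLaw
  have := h.pos
  split_ifs
  exacts [h.nonneg, h.pos.le, le_rfl]

theorem IsLazy.law_le_one {a b : ℝ} (h : IsLazy a b) (v : ℤ × ℤ) : sixLaw a b v ≤ 1 := by
  unfold sixLaw
  have h1 := h.nonneg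
  have h2 := h.pos
  have h3 := h.total
  split_ifs <;> linarith

theorem sixLaw_of_mem {a b : ℝ} {v : ℤ × ℤ} (hv : v ∈ sixSteps) : sixLaw a b v = b := by
  have h0 : v ≠ 0 := by rintro rfl; revert hv; decide
  rw [sixLaw, if_neg h0, if_pos hv]

theorem sixLaw_of_notMem {a b : ℝ} {v : ℤ × ℤ} (hv : v ∉ sevenSteps) : sixLaw a b v = 0 := by
  rw [sevenSteps, Finset.mem_insert, not_or] at hv
  rw [sixLaw, if_neg hv.1, if_neg hv.2]

theorem IsLazy.sum_law {a b : ℝ} (h : IsLazy a b) : ∑ v ∈ sevenSteps, sixLaw a b v = 1 := by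
  have := sum_sixLaw_mul a b (fun _ => (1 : ℝ))
  simp only [smul_eq_mul, mul_one] at this
  rw [this]
  linarith [h.total]

theorem abs_coord_le_one {v : ℤ × ℤ} (hv : v ∈ sevenSteps) :
    |(v.1 : ℝ)| ≤ 1 ∧ |(v.2 : ℝ)| ≤ 1 := by
  have : ∀ v ∈ sevenSteps, |v.1| ≤ 1 ∧ |v.2| ≤ 1 := by decide
  exact_mod_cast this v hv

/-- The `ℓ¹` norm on `ℝ × ℝ`. -/
def oneNorm (u : ℝ × ℝ) : ℝ := |u.1| + |u.2|

theorem oneNorm_nonneg (u : ℝ × ℝ) : 0 ≤ oneNorm u := by unfold oneNorm; positivity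

theorem abs_pair_le {u y : ℝ × ℝ} {M : ℝ} (h1 : |y.1| ≤ M) (h2 : |y.2| ≤ M) :
    |pair u y| ≤ oneNorm u * M := by
  unfold pair oneNorm
  refine (abs_add_le _ _).trans ?_
  rw [abs_mul, abs_mul, add_mul]
  gcongr

theorem abs_pair_step_le (u : ℝ × ℝ) {v : ℤ × ℤ} (hv : v ∈ sevenSteps) :
    |pair u (shift 0 v)| ≤ oneNorm u := by
  have h := abs_coord_le_one hv
  have := abs_pair_le (u := u) (y := shift 0 v) (M := 1) (by simpa [shift] using h.1)
    (by simpa [shift] using h.2)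
  rwa [mul_one] at this

theorem abs_exp_sub_one_le (x : ℝ) : |Real.exp x - 1| ≤ |x| * Real.exp |x| := by
  have h1 := Real.add_one_le_exp x
  have h2 := Real.add_one_le_exp (-x)
  have h3 : Real.exp x * Real.exp (-x) = 1 := by rw [← Real.exp_add]; simp
  have h4 := Real.exp_pos x
  rcases le_total 0 x with hx | hx
  · rw [abs_of_nonneg (by linarith), abs_of_nonneg hx]
    nlinarith
  · have h5 : Real.exp x ≤ 1 := Real.exp_le_one_iff.2 hx
    rw [abs_of_nonpos (by linarith), abs_of_nonpos hx]
    have h6 : 1 ≤ Real.exp (-x) := Real.one_le_exp (by linarith)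
    nlinarith

theorem expSum_sixLaw (a b : ℝ) (u : ℝ × ℝ) : expSum sevenSteps (sixLaw a b) u =
    a + 2 * b * (Real.cosh u.1 + Real.cosh u.2 + Real.cosh (u.1 - u.2)) := by
  have := sum_sixLaw_mul a b (fun v => Real.exp (pair u (shift 0 v)))
  simp only [smul_eq_mul] at this
  rw [expSum, this]
  simp only [Real.cosh_eq, pair, shift, Prod.fst_zero, Prod.snd_zero]
  norm_num
  ring_nf

theorem IsLazy.one_le_expSum {a b : ℝ} (h : IsLazy a b) (u : ℝ × ℝ) :
    1 ≤ expSum sevenSteps (sixLaw a b) u := by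
  rw [expSum_sixLaw]
  have h1 := Real.one_le_cosh u.1
  have h2 := Real.one_le_cosh u.2
  have h3 := Real.one_le_cosh (u.1 - u.2)
  have h4 := h.total
  have h5 := h.pos
  nlinarith

theorem IsLazy.expSum_pos {a b : ℝ} (h : IsLazy a b) (u : ℝ × ℝ) :
    0 < expSum sevenSteps (sixLaw a b) u := lt_of_lt_of_le one_pos (h.one_le_expSum u)

theorem IsLazy.expSum_le {a b : ℝ} (h : IsLazy a b) (u : ℝ × ℝ) :
    expSum sevenSteps (sixLaw a b) u ≤ Real.exp (oneNorm u) := by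
  have := abs_sum_mul_le (S := sevenSteps) (p := sixLaw a b)
    (f := fun v => Real.exp (pair u (shift 0 v))) (M := Real.exp (oneNorm u))
    (fun v _ => h.law_nonneg v) (fun v hv => by
      rw [abs_of_pos (Real.exp_pos _)]
      exact Real.exp_le_exp.2 ((le_abs_self _).trans (abs_pair_step_le u hv)))
  rw [h.sum_law, one_mul] at this
  exact (le_abs_self _).trans this

theorem abs_exp_pair_sub_one_le {u : ℝ × ℝ} {R : ℝ} (hu : oneNorm u ≤ R) {v : ℤ × ℤ}
    (hv : v ∈ sevenSteps) :
    |Real.exp (pair u (shift 0 v)) - 1| ≤ oneNorm u * Real.exp R := by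
  have h1 := abs_pair_step_le u hv
  have h2 := h1.trans hu
  have h3 := oneNorm_nonneg u
  refine (abs_exp_sub_one_le _).trans ?_
  gcongr

theorem IsLazy.expSum_sub_one_le {a b : ℝ} (h : IsLazy a b) {u : ℝ × ℝ} {R : ℝ}
    (hu : oneNorm u ≤ R) :
    |expSum sevenSteps (sixLaw a b) u - 1| ≤ oneNorm u * Real.exp R := by
  have := abs_sum_mul_le (S := sevenSteps) (p := sixLaw a b)
    (f := fun v => Real.exp (pair u (shift 0 v)) - 1) (M := oneNorm u * Real.exp R)
    (fun v _ => h.law_nonneg v) (fun v hv => abs_exp_pair_sub_one_le hu hv)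
  simpa only [mul_sub, mul_one, Finset.sum_sub_distrib, h.sum_law, one_mul,
    expSum] using this

/-- From `e^{⟨u,v⟩} ≥ e^{-R}` and `κ(u) ≤ e^R`. This is the uniform lower bound `c₀` required by the
local limit theorem. -/
theorem IsLazy.le_tilt {a b : ℝ} (h : IsLazy a b) {u : ℝ × ℝ} {R : ℝ} (hu : oneNorm u ≤ R)
    {v : ℤ × ℤ} (hv : v ∈ sixSteps) :
    b * Real.exp (-(2 * R)) ≤ tilt sevenSteps (sixLaw a b) u v := by
  rw [tilt, sixLaw_of_mem hv, mul_div_assoc]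
  refine mul_le_mul_of_nonneg_left ?_ h.pos.le
  rw [le_div_iff₀ (h.expSum_pos u)]
  have h1 := (abs_le.1 (abs_pair_step_le u (sixSteps_subset_sevenSteps hv))).1
  calc Real.exp (-(2 * R)) * expSum sevenSteps (sixLaw a b) u
      ≤ Real.exp (-(2 * R)) * Real.exp R := by
        gcongr
        exact (h.expSum_le u).trans (Real.exp_le_exp.2 hu)
    _ = Real.exp (-R) := by rw [← Real.exp_add]; congr 1; ring
    _ ≤ _ := Real.exp_le_exp.2 (by linarith)

theorem IsLazy.abs_tilt_sub_le {a b : ℝ} (h : IsLazy a b) {u : ℝ × ℝ} {R : ℝ}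
    (hu : oneNorm u ≤ R) {v : ℤ × ℤ} (hv : v ∈ sevenSteps) :
    |tilt sevenSteps (sixLaw a b) u v - sixLaw a b v| ≤ 2 * Real.exp R * oneNorm u := by
  have hκ := h.one_le_expSum u
  have e : tilt sevenSteps (sixLaw a b) u v - sixLaw a b v =
      sixLaw a b v * ((Real.exp (pair u (shift 0 v)) - 1) -
        (expSum sevenSteps (sixLaw a b) u - 1)) / expSum sevenSteps (sixLaw a b) u := by
    rw [tilt]
    field_simp
    ring
  rw [e, abs_div, abs_of_pos (h.expSum_pos u), div_le_iff₀ (h.expSum_pos u), abs_mul,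
    abs_of_nonneg (h.law_nonneg v)]
  have h1 := abs_exp_pair_sub_one_le hu hv
  have h2 := h.expSum_sub_one_le hu
  have h3 := abs_sub (Real.exp (pair u (shift 0 v)) - 1) (expSum sevenSteps (sixLaw a b) u - 1)
  have h4 : 0 ≤ 2 * Real.exp R * oneNorm u := by
    have := oneNorm_nonneg u
    positivity
  calc _ ≤ 1 * (2 * Real.exp R * oneNorm u) := by
        gcongr
        · exact h.law_le_one v
        · linarith
    _ ≤ (2 * Real.exp R * oneNorm u) * expSum sevenSteps (sixLaw a b) u := by nlinarith

/-! ## The maximizer in the rate function -/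

/-- The gradient of `log κ` at `u` is the mean of the tilted law, so this is the vanishing of the
derivative at a maximum, taken along the line `u + s e`. -/
theorem sum_tilt_mul_pair_of_max {S : Finset (ℤ × ℤ)} {w : ℤ × ℤ → ℝ} {u d : ℝ × ℝ}
    (h0 : 0 < expSum S w u)
    (hmax : ∀ z, pair z d - Real.log (expSum S w z) ≤ pair u d - Real.log (expSum S w u))
    (e : ℝ × ℝ) : ∑ v ∈ S, tilt S w u v * pair e (shift 0 v) = pair e d := by
  have hlin : ∀ (y : ℝ × ℝ) (s : ℝ), pair (u + s • e) y = pair u y + s * pair e y := fun y s => by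
    simp only [pair, Prod.fst_add, Prod.snd_add, Prod.smul_fst, Prod.smul_snd, smul_eq_mul]
    ring
  have hp : ∀ y : ℝ × ℝ, HasDerivAt (fun s : ℝ => pair (u + s • e) y) (pair e y) 0 := fun y => by
    simp_rw [hlin]
    simpa using ((hasDerivAt_id (0 : ℝ)).mul_const (pair e y)).const_add (pair u y)
  have hE : HasDerivAt (fun s : ℝ => expSum S w (u + s • e))
      (∑ v ∈ S, w v * (Real.exp (pair u (shift 0 v)) * pair e (shift 0 v))) 0 := by
    unfold expSum
    refine HasDerivAt.fun_sum fun v _ => ?_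
    have := ((hp (shift 0 v)).exp).const_mul (w v)
    simpa using this
  have hL := hE.log (by simpa using h0.ne')
  have hG := (hp d).sub hL
  have hloc : IsLocalMax (fun s : ℝ => pair (u + s • e) d - Real.log (expSum S w (u + s • e))) 0 :=
    Filter.Eventually.of_forall fun s => by simpa using hmax (u + s • e)
  have hz := hloc.hasDerivAt_eq_zero hG
  simp only [zero_smul, add_zero] at hz
  have e2 : ∑ v ∈ S, tilt S w u v * pair e (shift 0 v) =
      (∑ v ∈ S, w v * (Real.exp (pair u (shift 0 v)) * pair e (shift 0 v))) / expSum S w u := by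
    rw [Finset.sum_div]
    refine Finset.sum_congr rfl fun v _ => ?_
    rw [tilt]
    ring
  rw [e2]
  linarith

theorem sq_le_mul_sinh (x : ℝ) : x ^ 2 ≤ x * Real.sinh x := by
  rcases le_total 0 x with hx | hx
  · have := Real.self_le_sinh_iff.2 hx
    nlinarith
  · have := Real.sinh_le_self_iff.2 hx
    nlinarith

/-- The mean identity is tested in the direction `u` itself. By symmetry of the steps the left side
becomes a sum of terms `x sinh x ≥ x²` over `κ(u)`, so `⟨u,d⟩ κ(u)` dominates `b ‖u‖₁²`, while it is
at most `‖u‖₁ ‖d‖₁ e^R`. -/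
theorem IsLazy.oneNorm_le_of_mean {a b : ℝ} (h : IsLazy a b) {u d : ℝ × ℝ} {R : ℝ}
    (hu : oneNorm u ≤ R)
    (hd : ∑ v ∈ sevenSteps, tilt sevenSteps (sixLaw a b) u v * pair u (shift 0 v) = pair u d) :
    oneNorm u ≤ Real.exp R / b * oneNorm d := by
  have hκ := h.expSum_pos u
  have hb := h.pos
  have e : ∑ v ∈ sevenSteps, tilt sevenSteps (sixLaw a b) u v * pair u (shift 0 v) =
      2 * b * (u.1 * Real.sinh u.1 + u.2 * Real.sinh u.2 + (u.1 - u.2) * Real.sinh (u.1 - u.2)) /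
        expSum sevenSteps (sixLaw a b) u := by
    have := sum_sixLaw_mul a b
      (fun v => Real.exp (pair u (shift 0 v)) * pair u (shift 0 v))
    simp only [smul_eq_mul] at this
    have e1 : ∑ v ∈ sevenSteps, tilt sevenSteps (sixLaw a b) u v * pair u (shift 0 v) =
        (∑ v ∈ sevenSteps, sixLaw a b v * (Real.exp (pair u (shift 0 v)) * pair u (shift 0 v))) /
          expSum sevenSteps (sixLaw a b) u := by
      rw [Finset.sum_div]
      refine Finset.sum_congr rfl fun v _ => ?_
      rw [tilt]
      ring
    rw [e1, this]
    congr 1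
    simp only [Real.sinh_eq, pair, shift, Prod.fst_zero, Prod.snd_zero]
    norm_num
    ring_nf
  rw [e, div_eq_iff hκ.ne'] at hd
  have s1 := sq_le_mul_sinh u.1
  have s2 := sq_le_mul_sinh u.2
  have s3 := sq_le_mul_sinh (u.1 - u.2)
  have hN := oneNorm_nonneg u
  have hd0 := oneNorm_nonneg d
  have hpd : pair u d ≤ oneNorm u * oneNorm d := by
    refine (le_abs_self _).trans (abs_pair_le ?_ ?_) <;> unfold oneNorm <;>
      linarith [abs_nonneg d.1, abs_nonneg d.2]
  have hκR : expSum sevenSteps (sixLaw a b) u ≤ Real.exp R :=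
    (h.expSum_le u).trans (Real.exp_le_exp.2 hu)
  have hsq : oneNorm u ^ 2 ≤ 2 * (u.1 ^ 2 + u.2 ^ 2) := by
    unfold oneNorm
    nlinarith [sq_abs u.1, sq_abs u.2, sq_nonneg (|u.1| - |u.2|)]
  have key : b * oneNorm u ^ 2 ≤ oneNorm u * (oneNorm d * Real.exp R) := by
    calc b * oneNorm u ^ 2 ≤ b * (2 * (u.1 ^ 2 + u.2 ^ 2)) := by gcongr
      _ ≤ 2 * b * (u.1 * Real.sinh u.1 + u.2 * Real.sinh u.2 +
            (u.1 - u.2) * Real.sinh (u.1 - u.2)) := by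
          nlinarith [sq_nonneg (u.1 - u.2)]
      _ = pair u d * expSum sevenSteps (sixLaw a b) u := hd
      _ ≤ (oneNorm u * oneNorm d) * Real.exp R := by gcongr
      _ = _ := by ring
  rcases hN.eq_or_lt with h0 | h0
  · rw [← h0]
    positivity
  · rw [div_mul_eq_mul_div, le_div_iff₀ hb]
    have : oneNorm u * (oneNorm u * b) ≤ oneNorm u * (Real.exp R * oneNorm d) := by nlinarith
    exact le_of_mul_le_mul_left this h0

/-! ## The rate function on the step body -/

/-- The coordinates of a point of the Euclidean plane. -/
def coords (x : EuclideanSpace ℝ (Fin 2)) : ℝ × ℝ := (x 0, x 1)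

theorem inner_eq_pair (x y : EuclideanSpace ℝ (Fin 2)) :
    inner ℝ x y = pair (coords x) (coords y) := by
  simp [PiLp.inner_apply, Fin.sum_univ_two, pair, coords, mul_comm]

theorem coords_toPlane (v : ℤ × ℤ) : coords (toPlane v) = shift 0 v := by
  simp [coords, toPlane, shift]

theorem kappa_sixLaw (a b : ℝ) (u : EuclideanSpace ℝ (Fin 2)) :
    kappa (sixLaw a b) u = expSum sevenSteps (sixLaw a b) (coords u) := by
  rw [kappa, tsum_eq_sum (s := sevenSteps) fun v hv => by rw [sixLaw_of_notMem hv, zero_mul]]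
  simp only [expSum, inner_eq_pair, coords_toPlane]

/-- The distance from `x` to the complement is attained at a frontier point, hence is at least `ε`.
-/
theorem ball_subset_of_le_infDist_frontier {E : Type*} [NormedAddCommGroup E] [NormedSpace ℝ E]
    [FiniteDimensional ℝ E] {s : Set E} (hs : s ≠ univ) {x : E} (hx : x ∈ s) {ε : ℝ}
    (h : ε ≤ Metric.infDist x (frontier s)) : Metric.ball x ε ⊆ s := by
  obtain ⟨y, hy, hxy⟩ := exists_mem_frontier_infDist_compl_eq_dist hx hs
  intro z hz
  by_contra hzs
  have h1 : Metric.infDist x sᶜ ≤ dist x z := Metric.infDist_le_dist_of_mem hzs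
  have h2 : Metric.infDist x (frontier s) ≤ dist x y := Metric.infDist_le_dist_of_mem hy
  rw [Metric.mem_ball, dist_comm] at hz
  linarith

theorem finite_support_sixLaw (a b : ℝ) : {v | 0 < sixLaw a b v}.Finite :=
  sevenSteps.finite_toSet.subset fun v hv => by
    by_contra hv'
    have : sixLaw a b v = 0 := sixLaw_of_notMem hv'
    simp only [mem_ofPred_eq, this, lt_irrefl] at hv

theorem stepBody_sixLaw_ne_univ (a b : ℝ) : stepBody (sixLaw a b) ≠ univ := by
  intro h
  have hb : Bornology.IsBounded (convexHull ℝ (toPlane '' {v | 0 < sixLaw a b v})) :=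
    isBounded_convexHull.2 ((finite_support_sixLaw a b).image _).isBounded
  have h2 := hb.subset interior_subset
  rw [← stepBody, h] at h2
  exact NormedSpace.unbounded_univ ℝ (EuclideanSpace ℝ (Fin 2)) h2

/-- A linear functional on a convex hull is dominated by its value at some generator. Applied to `δ`
moved by `ε / 2` in the direction `u`, this gives the linear gain that makes the function to be
maximized coercive. -/
theorem exists_inner_add_le_of_mem_stepBody {a b ε : ℝ} (hε : 0 < ε)
    {δ : EuclideanSpace ℝ (Fin 2)} (hδ : δ ∈ stepBody (sixLaw a b))
    (h : ε ≤ Metric.infDist δ (frontier (stepBody (sixLaw a b))))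
    (u : EuclideanSpace ℝ (Fin 2)) :
    ∃ v, 0 < sixLaw a b v ∧ inner ℝ u δ + ε / 2 * ‖u‖ ≤ inner ℝ u (toPlane v) := by
  set z := δ + (ε / 2 / ‖u‖) • u with hz
  have hzb : z ∈ Metric.ball δ ε := by
    rw [Metric.mem_ball, dist_eq_norm, hz, add_sub_cancel_left, norm_smul, Real.norm_eq_abs,
      abs_of_nonneg (by positivity)]
    rcases eq_or_ne ‖u‖ 0 with h0 | h0
    · rw [h0, mul_zero]; exact hε
    · rw [div_mul_cancel₀ _ h0]; linarith
  have hzh : z ∈ convexHull ℝ (toPlane '' {v | 0 < sixLaw a b v}) :=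
    interior_subset (ball_subset_of_le_infDist_frontier (stepBody_sixLaw_ne_univ a b) hδ h hzb)
  have hconv : ConvexOn ℝ univ fun y : EuclideanSpace ℝ (Fin 2) => (inner ℝ u y : ℝ) :=
    (innerSL ℝ u).toLinearMap.convexOn convex_univ
  obtain ⟨y, ⟨v, hv, rfl⟩, hy⟩ := hconv.exists_ge_of_mem_convexHull (subset_univ _) hzh
  refine ⟨v, hv, le_trans (le_of_eq ?_) hy⟩
  rw [hz, inner_add_right, real_inner_smul_right, real_inner_self_eq_norm_sq]
  rcases eq_or_ne ‖u‖ 0 with h0 | h0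
  · simp [h0]
  · field_simp

theorem exists_le_sixLaw (a b : ℝ) : ∃ c : ℝ, 0 < c ∧ c ≤ 1 ∧
    ∀ v, 0 < sixLaw a b v → c ≤ sixLaw a b v := by
  by_cases hne : {v | 0 < sixLaw a b v}.Nonempty
  · obtain ⟨v, hv, hmin⟩ := (finite_support_sixLaw a b).exists_minimalFor (sixLaw a b) _ hne
    refine ⟨min (sixLaw a b v) 1, lt_min hv one_pos, min_le_right _ _, fun z hz => ?_⟩
    rcases le_total (sixLaw a b v) (sixLaw a b z) with h | h
    · exact (min_le_left _ _).trans h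
    · exact (min_le_left _ _).trans (hmin hz h)
  · exact ⟨1, one_pos, le_rfl, fun v hv => (hne ⟨v, hv⟩).elim⟩

/-- Away from the boundary of the step body the maximum defining the rate function is attained in
a fixed ball, and the law tilted by the maximizer `u` has mean `δ`. -/
theorem IsLazy.exists_maximizer {a b : ℝ} (h : IsLazy a b) {ε : ℝ} (hε : 0 < ε) :
    ∃ R : ℝ, 0 < R ∧ ∀ δ ∈ stepBody (sixLaw a b),
      ε ≤ Metric.infDist δ (frontier (stepBody (sixLaw a b))) →
      ∃ u : ℝ × ℝ, oneNorm u ≤ R ∧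
        rate (sixLaw a b) δ = pair u (coords δ) -
          Real.log (expSum sevenSteps (sixLaw a b) u) ∧
        ∀ e, ∑ v ∈ sevenSteps, tilt sevenSteps (sixLaw a b) u v * pair e (shift 0 v) =
          pair e (coords δ) := by
  obtain ⟨c, hc, hc1, hcl⟩ := exists_le_sixLaw a b
  -- Beyond this radius the bound `hgle` is negative, hence below the value `0` taken at the origin.
  set R₀ := 2 * (-Real.log c) / ε with hR₀
  have hlog : Real.log c ≤ 0 := Real.log_nonpos hc.le hc1
  have hR₀0 : 0 ≤ R₀ := div_nonneg (by linarith) hε.le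
  -- Each of the two coordinates is at most `R₀` in absolute value; the `1` keeps the bound positive
  -- if `R₀ = 0`.
  refine ⟨2 * R₀ + 1, by linarith, fun δ hδ hd => ?_⟩
  set g : EuclideanSpace ℝ (Fin 2) → ℝ := fun u =>
    inner ℝ u δ - Real.log (kappa (sixLaw a b) u) with hg
  have hκpos : ∀ u, 0 < kappa (sixLaw a b) u := fun u => by
    rw [kappa_sixLaw]; exact h.expSum_pos _
  have hgc : Continuous g := by
    refine (continuous_id.inner continuous_const).sub (Continuous.log ?_ fun u => (hκpos u).ne')
    have : kappa (sixLaw a b) = fun u => expSum sevenSteps (sixLaw a b) (coords u) :=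
      funext fun u => kappa_sixLaw a b u
    rw [this]
    unfold expSum pair coords
    fun_prop
  have hg0 : g 0 = 0 := by
    have : coords (0 : EuclideanSpace ℝ (Fin 2)) = 0 := by simp [coords]
    simp only [hg, inner_zero_left, kappa_sixLaw, this]
    simp [expSum, pair, h.sum_law]
  -- Here `κ(u)` is bounded below by its single term at the generator `v` that dominates in the
  -- direction `u`.
  have hgle : ∀ u, g u ≤ -Real.log c - ε / 2 * ‖u‖ := fun u => by
    obtain ⟨v, hv, hle⟩ := exists_inner_add_le_of_mem_stepBody hε hδ hd u
    have h1 : c * Real.exp (inner ℝ u (toPlane v)) ≤ kappa (sixLaw a b) u := by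
      have hvs : v ∈ sevenSteps := by
        by_contra hv'
        rw [sixLaw_of_notMem hv'] at hv
        exact lt_irrefl _ hv
      rw [kappa_sixLaw, inner_eq_pair, coords_toPlane]
      refine (mul_le_mul_of_nonneg_right (hcl v hv) (Real.exp_pos _).le).trans ?_
      exact Finset.single_le_sum
        (f := fun v => sixLaw a b v * Real.exp (pair (coords u) (shift 0 v)))
        (fun z _ => mul_nonneg (h.law_nonneg z) (Real.exp_pos _).le) hvs
    have h2 := Real.log_le_log (by positivity) h1
    rw [Real.log_mul hc.ne' (Real.exp_pos _).ne', Real.log_exp] at h2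
    simp only [hg]
    linarith
  obtain ⟨U, hUmem, hU⟩ := (isCompact_closedBall (0 : EuclideanSpace ℝ (Fin 2)) R₀).exists_isMaxOn
    ⟨0, Metric.mem_closedBall_self hR₀0⟩ hgc.continuousOn
  have hmax : ∀ z, g z ≤ g U := fun z => by
    by_cases hz : z ∈ Metric.closedBall 0 R₀
    · exact hU hz
    · have h0 : g 0 ≤ g U := hU (Metric.mem_closedBall_self hR₀0)
      rw [mem_closedBall_zero_iff, not_le, hR₀, div_lt_iff₀ hε] at hz
      have := hgle z
      rw [hg0] at h0
      linarith
  refine ⟨coords U, ?_, ?_, ?_⟩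
  · rw [mem_closedBall_zero_iff] at hUmem
    have h0 := PiLp.norm_apply_le U 0
    have h1 := PiLp.norm_apply_le U 1
    rw [Real.norm_eq_abs] at h0 h1
    simp only [oneNorm, coords]
    linarith
  · have hgr : IsGreatest (range g) (g U) :=
      ⟨mem_range_self U, by rintro _ ⟨z, rfl⟩; exact hmax z⟩
    rw [rate, hgr.csSup_eq]
    simp only [hg, kappa_sixLaw, inner_eq_pair]
  · refine sum_tilt_mul_pair_of_max (h.expSum_pos _) fun z => ?_
    have := hmax !₂[z.1, z.2]
    have hz : coords !₂[z.1, z.2] = z := by simp [coords]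
    simpa only [hg, kappa_sixLaw, inner_eq_pair, hz] using this

/-! ## The covariance determinant near the centre -/

theorem abs_one_div_sqrt_sub_le {A B c : ℝ} (hc : 0 < c) (hA : c ^ 2 ≤ A) (hB : c ^ 2 ≤ B) :
    |1 / √A - 1 / √B| ≤ |A - B| / c ^ 3 := by
  have hA' : c ≤ √A := Real.le_sqrt_of_sq_le hA
  have hB' : c ≤ √B := Real.le_sqrt_of_sq_le hB
  have hA0 : 0 < √A := hc.trans_le hA'
  have hB0 : 0 < √B := hc.trans_le hB'
  have sA : √A ^ 2 = A := Real.sq_sqrt ((sq_nonneg c).trans hA)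
  have sB : √B ^ 2 = B := Real.sq_sqrt ((sq_nonneg c).trans hB)
  have e : 1 / √A - 1 / √B = -(A - B) / (√A * √B * (√A + √B)) := by
    have h2 : A - B = (√A - √B) * (√A + √B) := by linear_combination sB - sA
    rw [h2]
    field_simp
    ring
  rw [e, abs_div, abs_neg, abs_of_pos (a := √A * √B * (√A + √B)) (by positivity)]
  refine div_le_div_of_nonneg_left (abs_nonneg _) (by positivity) ?_
  calc c ^ 3 = c * c * c := by ring
    _ ≤ √A * √B * (√A + √B) := by gcongr; linarith

theorem IsLazy.abs_sum_tilt_sub_le {a b : ℝ} (h : IsLazy a b) {u : ℝ × ℝ} {R : ℝ}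
    (hu : oneNorm u ≤ R) {f : ℤ × ℤ → ℝ} (hf : ∀ v ∈ sevenSteps, |f v| ≤ 1) :
    |∑ v ∈ sevenSteps, tilt sevenSteps (sixLaw a b) u v * f v -
      ∑ v ∈ sevenSteps, sixLaw a b v * f v| ≤ 14 * Real.exp R * oneNorm u := by
  rw [← Finset.sum_sub_distrib]
  refine (Finset.abs_sum_le_sum_abs _ _).trans ?_
  have hN := oneNorm_nonneg u
  have : ∀ v ∈ sevenSteps, |tilt sevenSteps (sixLaw a b) u v * f v - sixLaw a b v * f v| ≤
      2 * Real.exp R * oneNorm u := fun v hv => by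
    rw [← sub_mul, abs_mul]
    have h1 := h.abs_tilt_sub_le hu hv
    have h2 := hf v hv
    calc _ ≤ (2 * Real.exp R * oneNorm u) * 1 := by gcongr
      _ = _ := mul_one _
  refine (Finset.sum_le_sum this).trans_eq ?_
  rw [Finset.sum_const, show sevenSteps.card = 7 by decide, nsmul_eq_mul]
  push_cast
  ring

theorem cov_expand {S : Finset (ℤ × ℤ)} {p : ℤ × ℤ → ℝ} {d : ℝ × ℝ} (h1 : ∑ v ∈ S, p v = 1)
    (hd1 : ∑ v ∈ S, p v * v.1 = d.1) (hd2 : ∑ v ∈ S, p v * v.2 = d.2) :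
    covXX S p d = ∑ v ∈ S, p v * (v.1 * v.1 : ℝ) - d.1 * d.1 ∧
    covXY S p d = ∑ v ∈ S, p v * (v.1 * v.2 : ℝ) - d.1 * d.2 ∧
    covYY S p d = ∑ v ∈ S, p v * (v.2 * v.2 : ℝ) - d.2 * d.2 := by
  have key : ∀ (f g : ℤ × ℤ → ℝ) (s t : ℝ), ∑ v ∈ S, p v * f v = s → ∑ v ∈ S, p v * g v = t →
      ∑ v ∈ S, p v * ((f v - s) * (g v - t)) = ∑ v ∈ S, p v * (f v * g v) - s * t := by
    intro f g s t hs ht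
    have e : ∀ v, p v * ((f v - s) * (g v - t)) =
        p v * (f v * g v) - t * (p v * f v) - s * (p v * g v) + s * t * p v := fun v => by ring
    simp_rw [e, Finset.sum_add_distrib, Finset.sum_sub_distrib, ← Finset.mul_sum, hs, ht, h1]
    ring
  refine ⟨?_, key (fun v => v.1) (fun v => v.2) _ _ hd1 hd2, ?_⟩
  · rw [← key (fun v => v.1) (fun v => v.1) _ _ hd1 hd1]
    simp only [covXX, sq]
  · rw [← key (fun v => v.2) (fun v => v.2) _ _ hd2 hd2]
    simp only [covYY, sq]

/-- The weights `p` have mean `d`. -/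
def HasMean (S : Finset (ℤ × ℤ)) (p : ℤ × ℤ → ℝ) (d : ℝ × ℝ) : Prop :=
  ∀ e, ∑ v ∈ S, p v * pair e (shift 0 v) = pair e d

theorem HasMean.fst {S : Finset (ℤ × ℤ)} {p : ℤ × ℤ → ℝ} {d : ℝ × ℝ} (h : HasMean S p d) :
    ∑ v ∈ S, p v * v.1 = d.1 := by
  simpa [pair, shift] using h (1, 0)

theorem HasMean.snd {S : Finset (ℤ × ℤ)} {p : ℤ × ℤ → ℝ} {d : ℝ × ℝ} (h : HasMean S p d) :
    ∑ v ∈ S, p v * v.2 = d.2 := by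
  simpa [pair, shift] using h (0, 1)

theorem IsLazy.abs_mean_le_one {a b : ℝ} (h : IsLazy a b) {u d : ℝ × ℝ}
    (hd : HasMean sevenSteps (tilt sevenSteps (sixLaw a b) u) d) : |d.1| ≤ 1 ∧ |d.2| ≤ 1 := by
  have hp := tilt_nonneg (fun v _ => h.law_nonneg v) (h.expSum_pos u)
  have h1 := sum_tilt (h.expSum_pos u)
  constructor
  · rw [← hd.fst]
    have := abs_sum_mul_le (f := fun v => (v.1 : ℝ)) hp (fun v hv => (abs_coord_le_one hv).1)
    rwa [h1, one_mul] at this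
  · rw [← hd.snd]
    have := abs_sum_mul_le (f := fun v => (v.2 : ℝ)) hp (fun v hv => (abs_coord_le_one hv).2)
    rwa [h1, one_mul] at this

theorem sum_sixLaw_coords (a b : ℝ) :
    ∑ v ∈ sevenSteps, sixLaw a b v * (v.1 * v.1 : ℝ) = 4 * b ∧
    ∑ v ∈ sevenSteps, sixLaw a b v * (v.1 * v.2 : ℝ) = -(2 * b) ∧
    ∑ v ∈ sevenSteps, sixLaw a b v * (v.2 * v.2 : ℝ) = 4 * b := by
  have h1 := sum_sixLaw_mul a b (fun v => (v.1 * v.1 : ℝ))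
  have h2 := sum_sixLaw_mul a b (fun v => (v.1 * v.2 : ℝ))
  have h3 := sum_sixLaw_mul a b (fun v => (v.2 * v.2 : ℝ))
  simp only [smul_eq_mul] at h1 h2 h3
  rw [h1, h2, h3]
  refine ⟨?_, ?_, ?_⟩ <;> push_cast <;> simp <;> ring

/-- Each covariance entry differs from its value at `u = 0`, namely `4b`, `-2b`, `4b`, by the change
of the second moment plus a product of means, which is `O(‖d‖₁)`. The determinant `16b² - 4b² =
12b²` inherits the bound since all entries are bounded. -/
theorem IsLazy.abs_covDet_sub_le {a b : ℝ} (h : IsLazy a b) {u d : ℝ × ℝ} {R : ℝ}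
    (hu : oneNorm u ≤ R) (hd : HasMean sevenSteps (tilt sevenSteps (sixLaw a b) u) d) :
    |covDet sevenSteps (tilt sevenSteps (sixLaw a b) u) d - 12 * b ^ 2| ≤
      9 * (14 * Real.exp R * oneNorm u + oneNorm d) := by
  set p := tilt sevenSteps (sixLaw a b) u with hp
  have h1 : ∑ v ∈ sevenSteps, p v = 1 := sum_tilt (h.expSum_pos u)
  have hp0 : ∀ v ∈ sevenSteps, 0 ≤ p v :=
    tilt_nonneg (fun v _ => h.law_nonneg v) (h.expSum_pos u)
  obtain ⟨m1, m2⟩ := h.abs_mean_le_one hd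
  obtain ⟨eXX, eXY, eYY⟩ := cov_expand h1 hd.fst hd.snd
  obtain ⟨sXX, sXY, sYY⟩ := sum_sixLaw_coords a b
  set η := 14 * Real.exp R * oneNorm u + oneNorm d with hη
  have hmul : ∀ {x y : ℝ}, |x| ≤ 1 → |y| ≤ 1 → |x * y| ≤ |y| := fun {x y} hx hy => by
    rw [abs_mul]
    exact mul_le_of_le_one_left (abs_nonneg _) hx
  have hc : ∀ {f g : ℤ × ℤ → ℝ} {s t z : ℝ}, (∀ v ∈ sevenSteps, |f v| ≤ 1) →
      (∀ v ∈ sevenSteps, |g v| ≤ 1) → |s| ≤ 1 → |t| ≤ 1 → |t| ≤ oneNorm d →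
      ∑ v ∈ sevenSteps, sixLaw a b v * (f v * g v) = z →
      |∑ v ∈ sevenSteps, p v * (f v * g v) - s * t - z| ≤ η := by
    intro f g s t z hf hg hs ht htd hz
    have k1 := h.abs_sum_tilt_sub_le hu (f := fun v => f v * g v)
      (fun v hv => (hmul (hf v hv) (hg v hv)).trans (hg v hv))
    rw [hz] at k1
    have k2 := (hmul hs ht).trans htd
    have e : ∑ v ∈ sevenSteps, p v * (f v * g v) - s * t - z =
        (∑ v ∈ sevenSteps, p v * (f v * g v) - z) - s * t := by ring
    rw [e]
    exact (abs_sub _ _).trans (add_le_add k1 k2)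
  have hd1 : |d.1| ≤ oneNorm d := by unfold oneNorm; linarith [abs_nonneg d.2]
  have hd2 : |d.2| ≤ oneNorm d := by unfold oneNorm; linarith [abs_nonneg d.1]
  have f1 : ∀ v ∈ sevenSteps, |(v.1 : ℝ)| ≤ 1 := fun v hv => (abs_coord_le_one hv).1
  have f2 : ∀ v ∈ sevenSteps, |(v.2 : ℝ)| ≤ 1 := fun v hv => (abs_coord_le_one hv).2
  have bXX : |covXX sevenSteps p d - 4 * b| ≤ η := by
    rw [eXX]; exact hc f1 f1 m1 m1 hd1 sXX
  have bXY : |covXY sevenSteps p d - -(2 * b)| ≤ η := by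
    rw [eXY]; exact hc f1 f2 m1 m2 hd2 sXY
  have bYY : |covYY sevenSteps p d - 4 * b| ≤ η := by
    rw [eYY]; exact hc f2 f2 m2 m2 hd2 sYY
  have ub : ∀ {f : ℤ × ℤ → ℝ}, (∀ v ∈ sevenSteps, |f v| ≤ 1) →
      |∑ v ∈ sevenSteps, p v * f v| ≤ 1 := fun {f} hf => by
    have := abs_sum_mul_le hp0 hf
    rwa [h1, one_mul] at this
  have uYY : |covYY sevenSteps p d| ≤ 2 := by
    rw [eYY]
    refine (abs_sub _ _).trans ?_
    have k1 := ub (f := fun v => (v.2 * v.2 : ℝ))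
      (fun v hv => (hmul (f2 v hv) (f2 v hv)).trans (f2 v hv))
    have k2 := (hmul m2 m2).trans m2
    linarith
  have uXY : |covXY sevenSteps p d| ≤ 2 := by
    rw [eXY]
    refine (abs_sub _ _).trans ?_
    have k1 := ub (f := fun v => (v.1 * v.2 : ℝ))
      (fun v hv => (hmul (f1 v hv) (f2 v hv)).trans (f2 v hv))
    have k2 := (hmul m1 m2).trans m2
    linarith
  have hb := h.pos
  have hb6 : 6 * b ≤ 1 := by linarith [h.total, h.nonneg]
  have hη0 : 0 ≤ η := (abs_nonneg _).trans bXX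
  have e : covDet sevenSteps p d - 12 * b ^ 2 =
      (covXX sevenSteps p d - 4 * b) * covYY sevenSteps p d +
      4 * b * (covYY sevenSteps p d - 4 * b) -
      (covXY sevenSteps p d - -(2 * b)) * (covXY sevenSteps p d - 2 * b) := by
    unfold covDet; ring
  have u3 : |covXY sevenSteps p d - 2 * b| ≤ 3 := by
    refine (abs_sub _ _).trans ?_
    rw [abs_of_pos (a := 2 * b) (by positivity)]
    linarith
  rw [e]
  refine (abs_sub _ _).trans ((add_le_add_left (abs_add_le _ _) _).trans ?_)
  rw [abs_mul, abs_mul (4 * b), abs_mul (_ - -(2 * b)), abs_of_pos (a := 4 * b) (by positivity)]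
  calc _ ≤ η * 2 + 4 * b * η + η * 3 := by gcongr
    _ ≤ 9 * η := by nlinarith

/-! ## The local limit theorem for the seven step walk -/

theorem abs_setIntegral_square_le_one {f : ℝ × ℝ → ℝ} (hf : ∀ θ, |f θ| ≤ 1) :
    |∫ θ in square, f θ| ≤ (2 * Real.pi) ^ 2 := by
  have hpi := Real.pi_pos
  have hv : volume square = ENNReal.ofReal (2 * Real.pi) * ENNReal.ofReal (2 * Real.pi) := by
    rw [square, Measure.volume_eq_prod, Measure.prod_prod, Real.volume_Icc]
    congr 2 <;> ring
  have := norm_setIntegral_le_of_norm_le_const (μ := volume) (s := square) (f := f) (C := 1)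
    isCompact_square.measure_lt_top (fun θ _ => hf θ)
  rw [one_mul, measureReal_def, hv, ENNReal.toReal_mul, ENNReal.toReal_ofReal (by positivity),
    ← sq] at this
  exact this

theorem l1Norm_eq (δ : EuclideanSpace ℝ (Fin 2)) : l1Norm δ = oneNorm (coords δ) := rfl

/-- The common core of all three asymptotics. The pair `u`, `σ` depends on `δ` alone, while `x` need
only lie near `mδ`: at odd times the even vertices involved are not at the mean. The bound on `J`
without restriction on `m` serves the case `m = 0`. -/
theorem IsLazy.exists_local_limit {a b : ℝ} (h : IsLazy a b) {ε : ℝ} (hε : 0 < ε) :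
    ∃ C : ℝ, 0 < C ∧ ∀ δ ∈ stepBody (sixLaw a b),
      ε ≤ Metric.infDist δ (frontier (stepBody (sixLaw a b))) →
      ∃ (u : ℝ × ℝ) (σ : ℝ), oneNorm u ≤ C ∧ oneNorm u ≤ C * l1Norm δ ∧
        rate (sixLaw a b) δ = pair u (coords δ) - Real.log (expSum sevenSteps (sixLaw a b) u) ∧
        |δ 0| ≤ 1 ∧ |δ 1| ≤ 1 ∧ 0 ≤ σ ∧ σ ≤ C ∧ |σ - 1 / √(12 * b ^ 2)| ≤ C * l1Norm δ ∧
        ∀ (A : ℕ → ℤ × ℤ → ℝ) (T : Finset (ℤ × ℤ)) (g : ℤ × ℤ → ℝ) (x : ℤ × ℤ) (m : ℕ),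
          IsConvPow sevenSteps (sixLaw a b) A → (∀ s ∈ T, 0 ≤ g s) → 0 < expSum T g u →
          (∀ s ∈ T, |(s.1 : ℝ) - (x.1 - m * δ 0)| ≤ 2 ∧ |(s.2 : ℝ) - (x.2 - m * δ 1)| ≤ 2) →
          ∃ J : ℝ, ∑ s ∈ T, g s * A m (x - s) =
              Real.exp (-pair u (shift 0 x)) * expSum sevenSteps (sixLaw a b) u ^ m *
                expSum T g u * (J / (2 * Real.pi)) ∧
            |J| ≤ 2 * Real.pi ∧ (0 < m → |J - σ / m| ≤ C / (m : ℝ) ^ 2) := by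
  obtain ⟨R, hR, H⟩ := h.exists_maximizer hε
  have hb := h.pos
  set c₀ := b * Real.exp (-(2 * R)) with hc₀
  have hc₀0 : 0 < c₀ := by positivity
  -- All displacements that occur have coordinates at most `2` in absolute value, so their squared
  -- length is at most `8`.
  obtain ⟨C₁, hC₁, H₁⟩ := exists_abs_setIntegral_trigSum_sub_le hc₀0 (M := 8) (by norm_num)
  set C₂ := Real.exp R / b with hC₂
  have hC₂0 : 0 < C₂ := by positivity
  set c := c₀ / 2 with hc
  have hc0 : 0 < c := by positivity
  set C₃ := 9 * (14 * Real.exp R * C₂ + 1) / c ^ 3 with hC₃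
  have hC₃0 : 0 < C₃ := by positivity
  refine ⟨R + C₁ + C₂ + C₃ + 1 / c, by positivity, fun δ hδ hd => ?_⟩
  obtain ⟨u, hu, hrate, hmean⟩ := H δ hδ hd
  have hmean' : HasMean sevenSteps (tilt sevenSteps (sixLaw a b) u) (coords δ) := hmean
  set p := tilt sevenSteps (sixLaw a b) u with hp
  have hN := oneNorm_nonneg (coords δ)
  have hκ := h.expSum_pos u
  have hp0 : ∀ v ∈ sevenSteps, 0 ≤ p v := tilt_nonneg (fun v _ => h.law_nonneg v) hκ
  have hp1 : ∑ v ∈ sevenSteps, p v = 1 := sum_tilt hκ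
  have hp4 : ∀ v ∈ fourSteps, c₀ ≤ p v := fun v hv => h.le_tilt hu (fourSteps_subset_sixSteps hv)
  have hD := sq_le_covDet (coords δ) fourSteps_subset_sevenSteps hc₀0 hp0 hp4
  rw [← hc] at hD
  set D := covDet sevenSteps p (coords δ) with hDdef
  have hcD : c ≤ √D := Real.le_sqrt_of_sq_le hD
  have hD0 : 0 < √D := hc0.trans_le hcD
  have hu2 : oneNorm u ≤ C₂ * oneNorm (coords δ) := h.oneNorm_le_of_mean hu (hmean u)
  have hpi := Real.pi_pos
  have hcinv : 0 < 1 / c := by positivity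
  obtain ⟨m1, m2⟩ := h.abs_mean_le_one hmean'
  refine ⟨u, 1 / √D, ?_, ?_, hrate, m1, m2, by positivity, ?_, ?_, ?_⟩
  · linarith
  · rw [l1Norm_eq]
    refine hu2.trans (mul_le_mul_of_nonneg_right ?_ hN)
    linarith
  · have := one_div_le_one_div_of_le hc0 hcD
    linarith
  -- The comparison of inverse roots needs the lower bound `c²` for the limiting determinant as
  -- well.
  · have hcb : c ^ 2 ≤ 12 * b ^ 2 := by
      have h1 : Real.exp (-(2 * R)) ≤ 1 := Real.exp_le_one_iff.2 (by linarith)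
      have h2 : c ≤ b := by
        rw [hc, hc₀]
        nlinarith [Real.exp_pos (-(2 * R))]
      nlinarith
    have h1 := abs_one_div_sqrt_sub_le hc0 hD hcb
    have h2 := h.abs_covDet_sub_le hu hmean'
    rw [l1Norm_eq]
    calc _ ≤ _ := h1
      _ ≤ 9 * (14 * Real.exp R * (C₂ * oneNorm (coords δ)) + oneNorm (coords δ)) / c ^ 3 := by
          refine div_le_div_of_nonneg_right (h2.trans ?_) (by positivity)
          gcongr
      _ = C₃ * oneNorm (coords δ) := by rw [hC₃]; ring
      _ ≤ _ := by
          refine mul_le_mul_of_nonneg_right ?_ hN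
          linarith
  · intro A T g x m hA hg hT hx
    set q := tilt T g u with hq
    have hq0 : ∀ s ∈ T, 0 ≤ q s := tilt_nonneg hg hT
    have hq1 : ∑ s ∈ T, q s = 1 := sum_tilt hT
    set y : ℝ × ℝ := (x.1 - m * (coords δ).1, x.2 - m * (coords δ).2) with hy
    set I := ∫ θ in square, (trigSum sevenSteps p (shift (coords δ)) θ ^ m *
      trigSum T q (shift y) θ).re with hI
    have hform := hA.sum_eq_tilt hκ hT m x (coords δ)
    refine ⟨I / (2 * Real.pi), ?_, ?_, fun hm => ?_⟩
    · rw [hform, ← hp, ← hq, ← hy, ← hI, div_div, ← sq]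
    · have hI1 : |I| ≤ (2 * Real.pi) ^ 2 := by
        refine abs_setIntegral_square_le_one fun θ => (Complex.abs_re_le_norm _).trans ?_
        rw [norm_mul, norm_pow]
        have k1 := norm_trigSum_le_one (shift (coords δ)) hp0 hp1 θ
        have k2 := norm_trigSum_le_one (shift y) hq0 hq1 θ
        exact mul_le_one₀ (pow_le_one₀ (norm_nonneg _) k1) (norm_nonneg _) k2
      rw [abs_div, abs_of_pos (a := 2 * Real.pi) (by positivity), div_le_iff₀ (by positivity), ← sq]
      exact hI1
    · have hm' : (0 : ℝ) < m := by exact_mod_cast hm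
      have hsq : ∀ {s t : ℝ}, |s| ≤ 2 → |t| ≤ 2 → s ^ 2 + t ^ 2 ≤ 8 := fun {s t} hs ht => by
        have k1 := sq_le_sq' (abs_le.1 hs).1 (abs_le.1 hs).2
        have k2 := sq_le_sq' (abs_le.1 ht).1 (abs_le.1 ht).2
        linarith
      have := H₁ m sevenSteps T p q (coords δ) (shift y) hm fourSteps_subset_sevenSteps hp0 hp1 hp4
        hmean'.fst hmean'.snd (fun v hv => ?_) hq0 hq1 (fun s hs => hsq (hx s hs).1 (hx s hs).2)
      · rw [← hI, ← hDdef] at this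
        have e : I / (2 * Real.pi) - 1 / √D / m =
            (I - 2 * Real.pi / (m * √D)) / (2 * Real.pi) := by
          field_simp
        rw [e, abs_div, abs_of_pos (a := 2 * Real.pi) (by positivity)]
        calc _ ≤ |I - 2 * Real.pi / (m * √D)| :=
              div_le_self (abs_nonneg _) (by linarith [Real.pi_gt_three])
          _ ≤ C₁ / (m : ℝ) ^ 2 := this
          _ ≤ _ := by gcongr; linarith
      · obtain ⟨v1, v2⟩ := abs_coord_le_one hv
        refine hsq ((abs_sub _ _).trans ?_) ((abs_sub _ _).trans ?_) <;> linarith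

/-! ## The hexagonal walk in coordinates -/

theorem tau_add (x y : ℤ × ℤ) : tau (x + y) = tau x + tau y := by
  simp only [tau, Prod.fst_add, Prod.snd_add]
  push_cast
  ring

/-- The vertex of class `τ = 0` with position `y`. -/
def evenVertex (y : ℤ × ℤ) : Hex := ⟨(y.1 - y.2, y.1 + 2 * y.2), by
  have h : tau (y.1 - y.2, y.1 + 2 * y.2) = 0 := by
    have h3 : (3 : ZMod 3) = 0 := by decide
    simp only [tau]
    push_cast
    linear_combination ((y.1 : ZMod 3) + y.2) * h3
  rw [h]
  decide⟩

/-- The vertex of class `τ = 2` whose neighbour at `-λ₂` is `evenVertex y`. -/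
def oddVertex (y : ℤ × ℤ) : Hex := ⟨(y.1 - y.2, y.1 + 2 * y.2 + 1), by
  have h : tau (y.1 - y.2, y.1 + 2 * y.2 + 1) = 2 := by
    have h3 : (3 : ZMod 3) = 0 := by decide
    simp only [tau]
    push_cast
    linear_combination ((y.1 : ZMod 3) + y.2) * h3
  rw [h]
  decide⟩

theorem tau_evenVertex (y : ℤ × ℤ) : tau (evenVertex y).1 = 0 := by
  have h3 : (3 : ZMod 3) = 0 := by decide
  simp only [tau, evenVertex]
  push_cast
  linear_combination ((y.1 : ZMod 3) + y.2) * h3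

theorem tau_oddVertex (y : ℤ × ℤ) : tau (oddVertex y).1 = 2 := by
  have h3 : (3 : ZMod 3) = 0 := by decide
  simp only [tau, oddVertex]
  push_cast
  linear_combination ((y.1 : ZMod 3) + y.2) * h3

theorem tau_eq_zero_or_two (x : Hex) : tau x.1 = 0 ∨ tau x.1 = 2 := by
  have : ∀ t : ZMod 3, t ≠ 1 → t = 0 ∨ t = 2 := by decide
  exact this _ x.2

theorem exists_eq_evenVertex {x : Hex} (hx : tau x.1 = 0) : ∃ y, x = evenVertex y := by
  have h : ((x.1.1 + 2 * x.1.2 : ℤ) : ZMod 3) = 0 := by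
    rw [← hx, tau]; push_cast; ring
  rw [ZMod.intCast_zmod_eq_zero_iff_dvd] at h
  obtain ⟨k, hk⟩ := h
  push_cast at hk
  refine ⟨(2 * k - x.1.2, x.1.2 - k), ?_⟩
  refine Subtype.ext (Prod.ext ?_ ?_) <;> simp only [evenVertex] <;> omega

theorem exists_eq_oddVertex {x : Hex} (hx : tau x.1 = 2) : ∃ y, x = oddVertex y := by
  have h0 : tau (x.1 - (0, 1)) = 0 := by
    have := tau_add (x.1 - (0, 1)) (0, 1)
    rw [sub_add_cancel, hx] at this
    have e : tau (0, 1) = 2 := by decide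
    rw [e] at this
    simpa using this.symm
  obtain ⟨y, hy⟩ := exists_eq_evenVertex (x := ⟨x.1 - (0, 1), by rw [h0]; decide⟩) h0
  have h1 := congrArg (fun z : Hex => z.1.1) hy
  have h2 := congrArg (fun z : Hex => z.1.2) hy
  simp only [evenVertex, Prod.fst_sub, Prod.snd_sub] at h1 h2
  refine ⟨y, Subtype.ext (Prod.ext ?_ ?_)⟩ <;> simp only [oddVertex] <;> omega

theorem hexZero_eq : hexZero = evenVertex 0 := rfl

theorem mem_hexNeighborSteps_even {y d : ℤ × ℤ} :
    d ∈ hexNeighborSteps (evenVertex y) ↔ d = (0, 1) ∨ d = (-1, 0) ∨ d = (1, -1) := by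
  simp [hexNeighborSteps, tau_evenVertex]

theorem mem_hexNeighborSteps_odd {y d : ℤ × ℤ} :
    d ∈ hexNeighborSteps (oddVertex y) ↔ d = (1, 0) ∨ d = (0, -1) ∨ d = (-1, 1) := by
  have : (2 : ZMod 3) ≠ 0 := by decide
  simp [hexNeighborSteps, tau_oddVertex, this]

theorem oddVertex_sub_evenVertex_mem {y z : ℤ × ℤ} :
    (oddVertex z).1 - (evenVertex y).1 ∈ hexNeighborSteps (evenVertex y) ↔
      y = z ∨ y = z + (1, 0) ∨ y = z + (0, 1) := by
  rw [mem_hexNeighborSteps_even]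
  simp only [Prod.ext_iff, oddVertex, evenVertex, Prod.fst_sub, Prod.snd_sub, Prod.fst_add,
    Prod.snd_add]
  omega

theorem evenVertex_sub_oddVertex_mem {y z : ℤ × ℤ} :
    (evenVertex y).1 - (oddVertex z).1 ∈ hexNeighborSteps (oddVertex z) ↔
      z = y ∨ z = y - (1, 0) ∨ z = y - (0, 1) := by
  rw [mem_hexNeighborSteps_odd]
  simp only [Prod.ext_iff, oddVertex, evenVertex, Prod.fst_sub, Prod.snd_sub]
  omega

theorem evenVertex_sub_evenVertex_notMem {y z : ℤ × ℤ} :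
    (evenVertex z).1 - (evenVertex y).1 ∉ hexNeighborSteps (evenVertex y) := by
  rw [mem_hexNeighborSteps_even]
  simp only [Prod.ext_iff, evenVertex, Prod.fst_sub, Prod.snd_sub]
  omega

theorem oddVertex_sub_oddVertex_notMem {y z : ℤ × ℤ} :
    (oddVertex z).1 - (oddVertex y).1 ∉ hexNeighborSteps (oddVertex y) := by
  rw [mem_hexNeighborSteps_odd]
  simp only [Prod.ext_iff, oddVertex, Prod.fst_sub, Prod.snd_sub]
  omega

theorem evenVertex_injective : Function.Injective evenVertex := fun y z h => by
  have h1 := congrArg (fun z : Hex => z.1.1) h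
  have h2 := congrArg (fun z : Hex => z.1.2) h
  simp only [evenVertex] at h1 h2
  exact Prod.ext (by omega) (by omega)

theorem oddVertex_injective : Function.Injective oddVertex := fun y z h => by
  have h1 := congrArg (fun z : Hex => z.1.1) h
  have h2 := congrArg (fun z : Hex => z.1.2) h
  simp only [oddVertex] at h1 h2
  exact Prod.ext (by omega) (by omega)

/-- The offsets between an `oddVertex` and its neighbours among the `evenVertex`s. -/
def threeOffsets : Finset (ℤ × ℤ) := {(0, 0), (-1, 0), (0, -1)}

theorem sum_threeOffsets {M : Type*} [AddCommMonoid M] (f : ℤ × ℤ → M) :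
    ∑ s ∈ threeOffsets, f s = f (0, 0) + (f (-1, 0) + f (0, -1)) := by
  unfold threeOffsets
  rw [Finset.sum_insert (by decide), Finset.sum_insert (by decide), Finset.sum_singleton]

theorem nStep_succ_oddVertex (o : Hex) (n : ℕ) (z : ℤ × ℤ) :
    nStep hexStep (n + 1) o (oddVertex z) =
      ∑ s ∈ threeOffsets, 1 / 3 * nStep hexStep n o (evenVertex (z - s)) := by
  rw [nStep, tsum_eq_sum (s := threeOffsets.image fun s => evenVertex (z - s)) fun w hw => ?_,
    Finset.sum_image fun s _ t _ hst => sub_right_injective (evenVertex_injective hst)]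
  · refine Finset.sum_congr rfl fun s hs => ?_
    rw [hexStep, if_pos, mul_comm]
    rw [oddVertex_sub_evenVertex_mem]
    revert hs
    simp only [threeOffsets, Finset.mem_insert, Finset.mem_singleton]
    rintro (rfl | rfl | rfl) <;> simp [Prod.ext_iff]
  · rw [hexStep, if_neg, mul_zero]
    intro hmem
    rcases tau_eq_zero_or_two w with h | h
    · obtain ⟨y, rfl⟩ := exists_eq_evenVertex h
      rw [oddVertex_sub_evenVertex_mem] at hmem
      refine hw (Finset.mem_image.2 ⟨z - y, ?_, by rw [sub_sub_cancel]⟩)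
      rcases hmem with rfl | rfl | rfl <;> simp [threeOffsets, Prod.ext_iff]
    · obtain ⟨y, rfl⟩ := exists_eq_oddVertex h
      exact oddVertex_sub_oddVertex_notMem hmem

theorem nStep_succ_evenVertex (o : Hex) (n : ℕ) (y : ℤ × ℤ) :
    nStep hexStep (n + 1) o (evenVertex y) =
      ∑ s ∈ threeOffsets, 1 / 3 * nStep hexStep n o (oddVertex (y + s)) := by
  rw [nStep, tsum_eq_sum (s := threeOffsets.image fun s => oddVertex (y + s)) fun w hw => ?_,
    Finset.sum_image fun s _ t _ hst => add_right_injective _ (oddVertex_injective hst)]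
  · refine Finset.sum_congr rfl fun s hs => ?_
    rw [hexStep, if_pos, mul_comm]
    rw [evenVertex_sub_oddVertex_mem]
    revert hs
    simp only [threeOffsets, Finset.mem_insert, Finset.mem_singleton]
    rintro (rfl | rfl | rfl) <;> simp [Prod.ext_iff, sub_eq_add_neg]
  · rw [hexStep, if_neg, mul_zero]
    intro hmem
    rcases tau_eq_zero_or_two w with h | h
    · obtain ⟨y, rfl⟩ := exists_eq_evenVertex h
      exact evenVertex_sub_evenVertex_notMem hmem
    · obtain ⟨z, rfl⟩ := exists_eq_oddVertex h
      rw [evenVertex_sub_oddVertex_mem] at hmem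
      refine hw (Finset.mem_image.2 ⟨z - y, ?_, by rw [add_sub_cancel]⟩)
      rcases hmem with rfl | rfl | rfl <;> simp [threeOffsets, Prod.ext_iff]

theorem nStep_hexStep_nonneg (o : Hex) (n : ℕ) (x : Hex) : 0 ≤ nStep hexStep n o x := by
  induction n generalizing x with
  | zero => rw [nStep]; split_ifs <;> norm_num
  | succ n ih =>
    rw [nStep]
    refine tsum_nonneg fun z => mul_nonneg (ih z) ?_
    rw [hexStep]; split_ifs <;> norm_num

theorem evenVertex_ne_oddVertex (y z : ℤ × ℤ) : evenVertex y ≠ oddVertex z := fun h => by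
  have h1 := tau_evenVertex y
  rw [h, tau_oddVertex] at h1
  revert h1
  decide

theorem nStep_eq_zero_of_parity (n : ℕ) : ∀ y,
    (Even n → nStep hexStep n hexZero (oddVertex y) = 0) ∧
    (¬ Even n → nStep hexStep n hexZero (evenVertex y) = 0) := by
  induction n with
  | zero =>
    refine fun y => ⟨fun _ => ?_, fun h => (h Even.zero).elim⟩
    rw [nStep, if_neg]
    rw [hexZero_eq]
    exact evenVertex_ne_oddVertex _ _
  | succ n ih =>
    refine fun y => ⟨fun h => ?_, fun h => ?_⟩
    · rw [nStep_succ_oddVertex]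
      refine Finset.sum_eq_zero fun s _ => ?_
      rw [(ih _).2 (Nat.even_add_one.1 h), mul_zero]
    · rw [nStep_succ_evenVertex]
      refine Finset.sum_eq_zero fun s _ => ?_
      rw [(ih _).1 (by rwa [Nat.even_add_one, not_not] at h), mul_zero]

/-- Two steps move an even vertex by a difference of two of the three offsets. The difference `0`
arises three times and each of the six steps once, each with probability `1 / 9`. -/
theorem isConvPow_hex : IsConvPow sevenSteps hexTwoStepLaw
    (fun m y => nStep hexStep (2 * m) hexZero (evenVertex y)) where
  zero y := by
    simp only [nStep, hexZero_eq]
    refine if_congr ⟨fun h => (evenVertex_injective h).symm, fun h => by rw [h]⟩ rfl rfl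
  succ m y := by
    rw [show 2 * (m + 1) = 2 * m + 1 + 1 by ring, nStep_succ_evenVertex]
    simp_rw [nStep_succ_oddVertex, sum_threeOffsets]
    have := sum_sixLaw_mul (1 / 3) (1 / 9)
      (fun v => nStep hexStep (2 * m) hexZero (evenVertex (y - v)))
    simp only [smul_eq_mul] at this
    rw [hexTwoStepLaw_eq_sixLaw, this]
    obtain ⟨y1, y2⟩ := y
    simp only [Prod.mk_add_mk, Prod.mk_sub_mk, ← Prod.mk_zero_zero]
    ring_nf

/-! ## Irreducibility, period and periodicity classes -/

theorem nStep_succ_oddVertex_pos {o : Hex} {n : ℕ} {y s : ℤ × ℤ} (hs : s ∈ threeOffsets)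
    (h : 0 < nStep hexStep n o (evenVertex y)) :
    0 < nStep hexStep (n + 1) o (oddVertex (y + s)) := by
  rw [nStep_succ_oddVertex]
  refine Finset.sum_pos' (fun t _ => ?_) ⟨s, hs, ?_⟩
  · exact mul_nonneg (by norm_num) (nStep_hexStep_nonneg _ _ _)
  · rw [add_sub_cancel_right]
    positivity

theorem nStep_succ_evenVertex_pos {o : Hex} {n : ℕ} {z s : ℤ × ℤ} (hs : s ∈ threeOffsets)
    (h : 0 < nStep hexStep n o (oddVertex z)) :
    0 < nStep hexStep (n + 1) o (evenVertex (z - s)) := by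
  rw [nStep_succ_evenVertex]
  refine Finset.sum_pos' (fun t _ => ?_) ⟨s, hs, ?_⟩
  · exact mul_nonneg (by norm_num) (nStep_hexStep_nonneg _ _ _)
  · rw [sub_add_cancel]
    positivity

theorem forall_of_unit_moves {P : ℤ × ℤ → Prop} {y₀ : ℤ × ℤ} (h0 : P y₀)
    (h1 : ∀ y, P y → P (y + (1, 0))) (h2 : ∀ y, P y → P (y - (1, 0)))
    (h3 : ∀ y, P y → P (y + (0, 1))) (h4 : ∀ y, P y → P (y - (0, 1))) (y : ℤ × ℤ) : P y := by
  have key : ∀ (e y : ℤ × ℤ), (∀ y, P y → P (y + e)) → (∀ y, P y → P (y - e)) → P y →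
      ∀ k : ℤ, P (y + k • e) := by
    intro e y hp hm hy k
    induction k with
    | zero => simpa using hy
    | succ i ih => rw [add_smul, one_smul, ← add_assoc]; exact hp _ ih
    | pred i ih => rw [sub_smul, one_smul, ← add_sub_assoc]; exact hm _ ih
  have := key (0, 1) _ h3 h4 (key (1, 0) y₀ h1 h2 h0 (y.1 - y₀.1)) (y.2 - y₀.2)
  have e : y₀ + (y.1 - y₀.1) • ((1, 0) : ℤ × ℤ) + (y.2 - y₀.2) • ((0, 1) : ℤ × ℤ) = y := by
    refine Prod.ext ?_ ?_ <;> simp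
  rwa [e] at this

theorem isIrreducibleWalk_hexStep : IsIrreducibleWalk hexStep := by
  intro o x
  have hself : 0 < nStep hexStep 0 o o := by rw [nStep, if_pos rfl]; exact one_pos
  have z0 : ((0, 0) : ℤ × ℤ) ∈ threeOffsets := by decide
  have z1 : ((-1, 0) : ℤ × ℤ) ∈ threeOffsets := by decide
  have z2 : ((0, -1) : ℤ × ℤ) ∈ threeOffsets := by decide
  have hstart : ∃ y n, 0 < nStep hexStep n o (evenVertex y) := by
    rcases tau_eq_zero_or_two o with h | h
    · obtain ⟨y, rfl⟩ := exists_eq_evenVertex h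
      exact ⟨y, 0, hself⟩
    · obtain ⟨z, rfl⟩ := exists_eq_oddVertex h
      exact ⟨_, _, nStep_succ_evenVertex_pos z0 hself⟩
  obtain ⟨y₀, hy₀⟩ := hstart
  -- A step to an odd vertex and one back realize `s - t`; with one of the two offsets equal to zero
  -- these differences include the four unit moves.
  have move : ∀ {s t : ℤ × ℤ}, s ∈ threeOffsets → t ∈ threeOffsets → ∀ y,
      (∃ n, 0 < nStep hexStep n o (evenVertex y)) →
      ∃ n, 0 < nStep hexStep n o (evenVertex (y + s - t)) := fun hs ht y ⟨n, hn⟩ =>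
    ⟨_, nStep_succ_evenVertex_pos ht (nStep_succ_oddVertex_pos hs hn)⟩
  have hall : ∀ y, ∃ n, 0 < nStep hexStep n o (evenVertex y) := by
    refine forall_of_unit_moves hy₀ (fun y hy => ?_) (fun y hy => ?_) (fun y hy => ?_)
      (fun y hy => ?_)
    · have := move z0 z1 y hy
      rwa [add_sub_assoc, show ((0, 0) - (-1, 0) : ℤ × ℤ) = (1, 0) by decide] at this
    · have := move z1 z0 y hy
      rwa [add_sub_assoc, show ((-1, 0) - (0, 0) : ℤ × ℤ) = -(1, 0) by decide,
        ← sub_eq_add_neg] at this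
    · have := move z0 z2 y hy
      rwa [add_sub_assoc, show ((0, 0) - (0, -1) : ℤ × ℤ) = (0, 1) by decide] at this
    · have := move z2 z0 y hy
      rwa [add_sub_assoc, show ((0, -1) - (0, 0) : ℤ × ℤ) = -(0, 1) by decide,
        ← sub_eq_add_neg] at this
  rcases tau_eq_zero_or_two x with h | h
  · obtain ⟨y, rfl⟩ := exists_eq_evenVertex h
    exact hall y
  · obtain ⟨z, rfl⟩ := exists_eq_oddVertex h
    obtain ⟨n, hn⟩ := hall z
    have := nStep_succ_oddVertex_pos z0 hn
    exact ⟨n + 1, by rwa [Prod.mk_zero_zero, add_zero] at this⟩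

theorem even_of_nStep_evenVertex_pos {n : ℕ} {y : ℤ × ℤ}
    (h : 0 < nStep hexStep n hexZero (evenVertex y)) : Even n := by
  by_contra hn
  rw [(nStep_eq_zero_of_parity n y).2 hn] at h
  exact lt_irrefl _ h

theorem not_even_of_nStep_oddVertex_pos {n : ℕ} {y : ℤ × ℤ}
    (h : 0 < nStep hexStep n hexZero (oddVertex y)) : ¬ Even n := by
  intro hn
  rw [(nStep_eq_zero_of_parity n y).1 hn] at h
  exact lt_irrefl _ h

theorem isPeriod_hexStep : IsPeriod hexStep hexZero 2 := by
  intro d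
  refine ⟨fun hd n _ hn => hd.trans (even_iff_two_dvd.1 (even_of_nStep_evenVertex_pos (y := 0) hn)),
    fun h => h 2 two_pos ?_⟩
  have hself : 0 < nStep hexStep 0 hexZero (evenVertex 0) := by
    rw [nStep, hexZero_eq, if_pos rfl]; exact one_pos
  have z0 : ((0, 0) : ℤ × ℤ) ∈ threeOffsets := by decide
  exact nStep_succ_evenVertex_pos z0 (nStep_succ_oddVertex_pos z0 hself)

theorem periodClass_zero : periodClass hexStep hexZero 2 0 = {x | tau x.1 = 0} := by
  ext x
  refine ⟨fun ⟨k, hk⟩ => ?_, fun hx => ?_⟩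
  · rcases tau_eq_zero_or_two x with h | h
    · exact h
    · obtain ⟨z, rfl⟩ := exists_eq_oddVertex h
      exact (not_even_of_nStep_oddVertex_pos hk (by simp)).elim
  · obtain ⟨y, rfl⟩ := exists_eq_evenVertex hx
    obtain ⟨n, hn⟩ := isIrreducibleWalk_hexStep hexZero (evenVertex y)
    obtain ⟨k, rfl⟩ := even_of_nStep_evenVertex_pos hn
    exact ⟨k, by rwa [zero_add, mul_two]⟩

theorem periodClass_one : periodClass hexStep hexZero 2 1 = {x | tau x.1 = 2} := by
  ext x
  refine ⟨fun ⟨k, hk⟩ => ?_, fun hx => ?_⟩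
  · rcases tau_eq_zero_or_two x with h | h
    · obtain ⟨y, rfl⟩ := exists_eq_evenVertex h
      have := even_of_nStep_evenVertex_pos hk
      rw [Nat.even_add, Nat.even_mul] at this
      simp at this
    · exact h
  · obtain ⟨z, rfl⟩ := exists_eq_oddVertex hx
    obtain ⟨n, hn⟩ := isIrreducibleWalk_hexStep hexZero (oddVertex z)
    obtain ⟨k, rfl⟩ := Nat.not_even_iff_odd.1 (not_even_of_nStep_oddVertex_pos hn)
    exact ⟨k, by rwa [add_comm, mul_comm]⟩

/-! ## The triangular walk -/

theorem isConvPow_tri : IsConvPow sevenSteps triLaw (fun n x => nStep triStep n (0, 0) x) where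
  zero x := by
    rw [nStep]
    exact if_congr eq_comm rfl rfl
  succ n x := by
    rw [nStep, ← (Equiv.subLeft x).tsum_eq, tsum_eq_sum (s := sevenSteps) fun v hv => ?_]
    · refine Finset.sum_congr rfl fun v _ => ?_
      rw [triStep, Equiv.subLeft_apply, sub_sub_cancel, mul_comm]
    · rw [triStep, Equiv.subLeft_apply, sub_sub_cancel, triLaw_eq_sixLaw, sixLaw_of_notMem hv,
        mul_zero]

/-! ## The two lattices -/

theorem isLazy_tri : IsLazy 0 (1 / 6) := ⟨le_rfl, by norm_num, by norm_num⟩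

theorem isLazy_hex : IsLazy (1 / 3) (1 / 9) := ⟨by norm_num, by norm_num, by norm_num⟩

theorem one_div_sqrt_tri : 1 / √(12 * (1 / 6 : ℝ) ^ 2) = √3 := by
  rw [show (12 * (1 / 6 : ℝ) ^ 2) = 3⁻¹ by norm_num, Real.sqrt_inv, one_div, inv_inv]

theorem one_div_sqrt_hex : 1 / √(12 * (1 / 9 : ℝ) ^ 2) = 3 * √3 / 2 := by
  rw [show (12 * (1 / 9 : ℝ) ^ 2) = 3 * (2 / 9) ^ 2 by norm_num, Real.sqrt_mul (by norm_num),
    Real.sqrt_sq (by norm_num)]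
  have h3 : √3 ^ 2 = (3 : ℝ) := Real.sq_sqrt (by norm_num)
  field_simp
  linarith

/-- Converts the rate function at its maximizer into the tilting prefactor. The exponent is real
because `n / 2` is a half-integer at odd times. -/
theorem exp_neg_mul_sub_log {s p κ : ℝ} (hκ : 0 < κ) :
    Real.exp (-s * (p - Real.log κ)) = Real.exp (-(s * p)) * κ ^ s := by
  rw [Real.rpow_def_of_pos hκ, ← Real.exp_add]
  congr 1
  ring

theorem expSum_singleton_zero (u : ℝ × ℝ) : expSum {0} (fun _ => 1) u = 1 := by
  simp [expSum, pair, shift]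

theorem coords_triDelta (n : ℕ) (x : ℤ × ℤ) :
    coords (triDelta n x) = ((x.1 : ℝ) / n, (x.2 : ℝ) / n) := by
  simp [coords, triDelta]

theorem triangular_local_limit {ε : ℝ} (hε : 0 < ε) : ∃ C : ℝ, 0 < C ∧
    ∀ n : ℕ, 0 < n → ∀ x : ℤ × ℤ, triDelta n x ∈ stepBody triLaw →
      ε ≤ Metric.infDist (triDelta n x) (frontier (stepBody triLaw)) →
      ∃ E₁ E₂ : ℝ, |E₁| ≤ C * l1Norm (triDelta n x) ∧ |E₂| ≤ C * (n : ℝ)⁻¹ ∧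
        nStep triStep n (0, 0) x = (2 * Real.pi * n)⁻¹ *
          Real.exp (-(n : ℝ) * rate triLaw (triDelta n x)) * (√3 + E₁ + E₂) := by
  obtain ⟨C, hC, H⟩ := isLazy_tri.exists_local_limit hε
  have hA := isConvPow_tri
  rw [triLaw_eq_sixLaw] at hA ⊢
  refine ⟨C, hC, fun n hn x hx hd => ?_⟩
  obtain ⟨u, σ, -, -, hrate, -, -, -, -, hσ, hloc⟩ := H _ hx hd
  rw [one_div_sqrt_tri] at hσ
  have hn' : (0 : ℝ) < n := by exact_mod_cast hn
  have hδ := coords_triDelta n x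
  have hδ0 : triDelta n x 0 = x.1 / n := congrArg Prod.fst hδ
  have hδ1 : triDelta n x 1 = x.2 / n := congrArg Prod.snd hδ
  obtain ⟨J, hJ, -, hJσ⟩ := hloc _ {0} (fun _ => 1) x n hA (fun _ _ => zero_le_one)
    (by rw [expSum_singleton_zero]; exact one_pos) (fun s hs => by
      rw [Finset.mem_singleton.1 hs, hδ0, hδ1, mul_div_cancel₀ _ hn'.ne',
        mul_div_cancel₀ _ hn'.ne']
      simp)
  rw [expSum_singleton_zero, Finset.sum_singleton, one_mul, sub_zero, mul_one] at hJ
  -- The exact prefactor is `n J`. It is split at `σ`, which carries the dependence on `δ`, leaving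
  -- the Gaussian error for the second term.
  refine ⟨σ - √3, n * J - σ, hσ, ?_, ?_⟩
  · have e : n * J - σ = n * (J - σ / n) := by field_simp
    rw [e, abs_mul, abs_of_pos hn']
    calc _ ≤ n * (C / (n : ℝ) ^ 2) := by gcongr; exact hJσ hn
      _ = C * (n : ℝ)⁻¹ := by field_simp
  · have hp : (n : ℝ) * pair u (coords (triDelta n x)) = pair u (shift 0 x) := by
      rw [hδ]
      simp only [pair, shift, Prod.fst_zero, Prod.snd_zero]
      field_simp
      ring
    rw [hJ, hrate, exp_neg_mul_sub_log (isLazy_tri.expSum_pos u), hp, Real.rpow_natCast]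
    field_simp
    ring

theorem coords_hexDelta_evenVertex (m : ℕ) (y : ℤ × ℤ) :
    coords (hexDelta (2 * m) (evenVertex y)) = ((y.1 : ℝ) / m, (y.2 : ℝ) / m) := by
  simp only [coords, hexDelta, evenVertex]
  push_cast
  refine Prod.ext ?_ ?_ <;> simp <;> ring

theorem coords_hexDelta_oddVertex (n : ℕ) (y : ℤ × ℤ) :
    coords (hexDelta n (oddVertex y)) =
      (((y.1 : ℝ) + 1 / 3) / (n / 2), ((y.2 : ℝ) + 1 / 3) / (n / 2)) := by
  simp only [coords, hexDelta, oddVertex]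
  push_cast
  refine Prod.ext ?_ ?_ <;> simp <;> ring

theorem hexagonal_local_limit_even {ε : ℝ} (hε : 0 < ε) : ∃ C : ℝ, 0 < C ∧
    ∀ m : ℕ, 0 < m → ∀ y : ℤ × ℤ,
      hexDelta (2 * m) (evenVertex y) ∈ stepBody hexTwoStepLaw →
      ε ≤ Metric.infDist (hexDelta (2 * m) (evenVertex y)) (frontier (stepBody hexTwoStepLaw)) →
      ∃ E₁ E₂ : ℝ, |E₁| ≤ C * l1Norm (hexDelta (2 * m) (evenVertex y)) ∧
        |E₂| ≤ C * ((2 * m : ℕ) : ℝ)⁻¹ ∧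
        nStep hexStep (2 * m) hexZero (evenVertex y) = (2 * Real.pi * (2 * m : ℕ))⁻¹ *
          Real.exp (-(((2 * m : ℕ) : ℝ) / 2) *
            rate hexTwoStepLaw (hexDelta (2 * m) (evenVertex y))) * (3 * √3 + E₁ + E₂) := by
  obtain ⟨C, hC, H⟩ := isLazy_hex.exists_local_limit hε
  have hA := isConvPow_hex
  rw [hexTwoStepLaw_eq_sixLaw] at hA ⊢
  -- Since `1 / m = 2 / n`, the prefactor is `2 m J`; its Gaussian error `2 C / m` equals `4 C / n`.
  refine ⟨4 * C, by positivity, fun m hm y hy hd => ?_⟩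
  obtain ⟨u, σ, -, -, hrate, -, -, -, -, hσ, hloc⟩ := H _ hy hd
  rw [one_div_sqrt_hex] at hσ
  have hm' : (0 : ℝ) < m := by exact_mod_cast hm
  have hδ := coords_hexDelta_evenVertex m y
  have hδ0 : hexDelta (2 * m) (evenVertex y) 0 = y.1 / m := congrArg Prod.fst hδ
  have hδ1 : hexDelta (2 * m) (evenVertex y) 1 = y.2 / m := congrArg Prod.snd hδ
  obtain ⟨J, hJ, -, hJσ⟩ := hloc _ {0} (fun _ => 1) y m hA (fun _ _ => zero_le_one)
    (by rw [expSum_singleton_zero]; exact one_pos) (fun s hs => by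
      rw [Finset.mem_singleton.1 hs, hδ0, hδ1, mul_div_cancel₀ _ hm'.ne',
        mul_div_cancel₀ _ hm'.ne']
      simp)
  rw [expSum_singleton_zero, Finset.sum_singleton, one_mul, sub_zero, mul_one] at hJ
  refine ⟨2 * σ - 3 * √3, 2 * (m * J - σ), ?_, ?_, ?_⟩
  · rw [show 2 * σ - 3 * √3 = 2 * (σ - 3 * √3 / 2) by ring, abs_mul, abs_two]
    have := (abs_nonneg _).trans hσ
    linarith
  · have e : 2 * (m * J - σ) = 2 * (m * (J - σ / m)) := by field_simp
    rw [e, abs_mul, abs_mul, abs_of_pos hm', abs_two]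
    calc _ ≤ 2 * (m * (C / (m : ℝ) ^ 2)) := by gcongr; exact hJσ hm
      _ = 4 * C * ((2 * m : ℕ) : ℝ)⁻¹ := by push_cast; field_simp; norm_num
  · have hp : (m : ℝ) * pair u (coords (hexDelta (2 * m) (evenVertex y))) =
        pair u (shift 0 y) := by
      rw [hδ]
      simp only [pair, shift, Prod.fst_zero, Prod.snd_zero]
      field_simp
      ring
    have h2m : ((2 * m : ℕ) : ℝ) / 2 = m := by push_cast; field_simp
    rw [hJ, h2m, hrate, exp_neg_mul_sub_log (isLazy_hex.expSum_pos u), hp, Real.rpow_natCast]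
    push_cast
    field_simp
    ring

/-! ### The last step of the hexagonal walk at odd times -/

theorem expSum_threeOffsets_pos (u : ℝ × ℝ) : 0 < expSum threeOffsets (fun _ => 1 / 3) u := by
  rw [expSum, sum_threeOffsets]
  positivity

/-- The position of `oddVertex y` entering `δ` is `y + (1/3, 1/3)`. The exponential accounts for
this offset by moving the barycentre of the three offsets to the origin; only the boundedness of the
recentred offsets is used. -/
theorem abs_exp_mul_expSum_threeOffsets_sub_one_le {u : ℝ × ℝ} {R : ℝ} (hu : oneNorm u ≤ R) :
    |Real.exp (pair u (1 / 3, 1 / 3)) * expSum threeOffsets (fun _ => 1 / 3) u - 1| ≤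
      oneNorm u * Real.exp R := by
  have hN := oneNorm_nonneg u
  have hs : ∀ s ∈ threeOffsets,
      |Real.exp (pair u (shift (-(1 / 3), -(1 / 3)) s)) - 1| ≤ oneNorm u * Real.exp R := by
    intro s hs
    have h1 : |pair u (shift (-(1 / 3), -(1 / 3)) s)| ≤ oneNorm u * 1 := by
      refine abs_pair_le ?_ ?_ <;> revert hs <;>
        simp only [threeOffsets, Finset.mem_insert, Finset.mem_singleton, shift] <;>
        rintro (rfl | rfl | rfl) <;> norm_num [abs_le]
    rw [mul_one] at h1
    refine (abs_exp_sub_one_le _).trans ?_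
    have h2 := h1.trans hu
    gcongr
  have hone : ∑ _s ∈ threeOffsets, (1 / 3 : ℝ) = 1 := by rw [sum_threeOffsets]; norm_num
  have := abs_sum_mul_le (p := fun _ => (1 / 3 : ℝ)) (fun _ _ => by norm_num) hs
  rw [hone, one_mul] at this
  convert this using 2
  simp only [mul_sub, mul_one, Finset.sum_sub_distrib, hone]
  rw [expSum, Finset.mul_sum]
  congr 1
  refine Finset.sum_congr rfl fun s _ => ?_
  rw [mul_left_comm, ← Real.exp_add]
  congr 2
  simp only [pair, shift, Prod.fst_zero, Prod.snd_zero]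
  ring

theorem abs_sqrt_sub_one_le {κ : ℝ} (h : 1 ≤ κ) : |√κ - 1| ≤ |κ - 1| := by
  have h1 : 1 ≤ √κ := Real.one_le_sqrt.2 h
  have h2 : √κ ^ 2 = κ := Real.sq_sqrt (by linarith)
  rw [abs_of_nonneg (by linarith), abs_of_nonneg (by linarith)]
  nlinarith

theorem abs_div_sqrt_sub_one_le {Q κ : ℝ} (h : 1 ≤ κ) :
    |Q / √κ - 1| ≤ |Q - 1| + |κ - 1| := by
  have h1 : 1 ≤ √κ := Real.one_le_sqrt.2 h
  have e : Q / √κ - 1 = ((Q - 1) - (√κ - 1)) / √κ := by field_simp; ring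
  rw [e, abs_div, abs_of_pos (a := √κ) (by linarith)]
  refine (div_le_self (abs_nonneg _) h1).trans ((abs_sub _ _).trans ?_)
  exact add_le_add le_rfl (abs_sqrt_sub_one_le h)

/-- For `m ≥ 1` the mismatch between `2m + 1` and `2m` leaves the extra term `σ / m`, and `2m + 1 ≤
3m` yields `12 C`. For `m = 0` there is no asymptotic information and the crude bounds on `J` and
`σ` suffice. -/
theorem abs_odd_mul_sub_le {C J σ : ℝ} {m : ℕ} (hC : 0 < C) (hJ : |J| ≤ 2 * Real.pi)
    (hσ0 : 0 ≤ σ) (hσC : σ ≤ C) (h : 0 < m → |J - σ / m| ≤ C / (m : ℝ) ^ 2) :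
    |((2 * m + 1 : ℕ) : ℝ) * J - 2 * σ| ≤ (12 * C + 2 * Real.pi) * ((2 * m + 1 : ℕ) : ℝ)⁻¹ := by
  have hpi := Real.pi_pos
  rcases Nat.eq_zero_or_pos m with rfl | hm
  · simp only [mul_zero, zero_add, Nat.cast_one, one_mul, inv_one, mul_one]
    refine (abs_sub _ _).trans ?_
    rw [abs_of_nonneg (a := 2 * σ) (by positivity)]
    linarith
  · have hm1 : (1 : ℝ) ≤ m := by exact_mod_cast hm
    have hm' : (0 : ℝ) < m := by linarith
    have e : ((2 * m + 1 : ℕ) : ℝ) * J - 2 * σ = (2 * m + 1) * (J - σ / m) + σ / m := by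
      push_cast
      field_simp
      ring
    rw [e, ← div_eq_mul_inv, le_div_iff₀ (by positivity)]
    push_cast
    have h1 : |(2 * (m : ℝ) + 1) * (J - σ / m) + σ / m| ≤ 3 * m * (C / (m : ℝ) ^ 2) + C / m := by
      refine (abs_add_le _ _).trans ?_
      rw [abs_mul, abs_of_pos (a := 2 * (m : ℝ) + 1) (by positivity),
        abs_of_nonneg (a := σ / m) (by positivity)]
      gcongr
      · linarith
      · exact h hm
    calc _ ≤ (3 * m * (C / (m : ℝ) ^ 2) + C / m) * (3 * m) := by gcongr; linarith
      _ = 12 * C := by field_simp; ring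
      _ ≤ _ := by linarith

/-- The walk makes `m` two-step moves and one final step, which is the mixture over `threeOffsets`.
The exponent `n / 2 = m + 1/2` asks for an additional `√κ(u)`; together with the offset `(1/3, 1/3)`
and the mixture this forms the factor `ρ = 1 + O(‖u‖₁)`. -/
theorem hexagonal_local_limit_odd {ε : ℝ} (hε : 0 < ε) : ∃ C : ℝ, 0 < C ∧
    ∀ (m : ℕ) (y : ℤ × ℤ),
      hexDelta (2 * m + 1) (oddVertex y) ∈ stepBody hexTwoStepLaw →
      ε ≤ Metric.infDist (hexDelta (2 * m + 1) (oddVertex y))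
        (frontier (stepBody hexTwoStepLaw)) →
      ∃ E₁ E₂ : ℝ, |E₁| ≤ C * l1Norm (hexDelta (2 * m + 1) (oddVertex y)) ∧
        |E₂| ≤ C * ((2 * m + 1 : ℕ) : ℝ)⁻¹ ∧
        nStep hexStep (2 * m + 1) hexZero (oddVertex y) = (2 * Real.pi * (2 * m + 1 : ℕ))⁻¹ *
          Real.exp (-(((2 * m + 1 : ℕ) : ℝ) / 2) *
            rate hexTwoStepLaw (hexDelta (2 * m + 1) (oddVertex y))) * (3 * √3 + E₁ + E₂) := by
  obtain ⟨C, hC, H⟩ := isLazy_hex.exists_local_limit hε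
  have hA := isConvPow_hex
  rw [hexTwoStepLaw_eq_sixLaw] at hA ⊢
  have hpi := Real.pi_pos
  set B := 2 * Real.exp C * C with hB
  have hB0 : 0 < B := by positivity
  refine ⟨2 * C * B + 2 * C + (1 + 2 * B) * (12 * C + 2 * Real.pi), by positivity,
    fun m y hy hd => ?_⟩
  have hδ := coords_hexDelta_oddVertex (2 * m + 1) y
  set δ := hexDelta (2 * m + 1) (oddVertex y) with hδdef
  obtain ⟨u, σ, hu, huδ, hrate, hδ0, hδ1, hσ0, hσC, hσ, hloc⟩ := H _ hy hd
  rw [one_div_sqrt_hex] at hσ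
  set n : ℕ := 2 * m + 1 with hn
  have hnm : (n : ℝ) = 2 * m + 1 := by rw [hn]; push_cast; ring
  have hn' : (0 : ℝ) < n := by rw [hnm]; positivity
  -- Since `(m + 1/2) δ = y + (1/3, 1/3)`, the point `y` misses the mean `mδ` by `δ/2 - (1/3, 1/3)`,
  -- within the margin allowed by the local limit theorem.
  have p0 : (y.1 : ℝ) - m * δ 0 = δ 0 / 2 - 1 / 3 := by
    have : δ 0 = ((y.1 : ℝ) + 1 / 3) / (n / 2) := congrArg Prod.fst hδ
    rw [eq_div_iff (by positivity), hnm] at this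
    linarith
  have p1 : (y.2 : ℝ) - m * δ 1 = δ 1 / 2 - 1 / 3 := by
    have : δ 1 = ((y.2 : ℝ) + 1 / 3) / (n / 2) := congrArg Prod.snd hδ
    rw [eq_div_iff (by positivity), hnm] at this
    linarith
  have hX := expSum_threeOffsets_pos u
  obtain ⟨J, hJ, hJpi, hJσ⟩ := hloc _ threeOffsets (fun _ => 1 / 3) y m hA
    (fun _ _ => by norm_num) hX (fun s hs => by
      rw [p0, p1]
      rw [abs_le] at hδ0 hδ1
      revert hs
      simp only [threeOffsets, Finset.mem_insert, Finset.mem_singleton]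
      rintro (rfl | rfl | rfl) <;> refine ⟨abs_le.2 ⟨?_, ?_⟩, abs_le.2 ⟨?_, ?_⟩⟩ <;> push_cast <;>
        linarith)
  rw [← nStep_succ_oddVertex] at hJ
  set κ := expSum sevenSteps (sixLaw (1 / 3) (1 / 9)) u with hκ
  have hκ1 : 1 ≤ κ := isLazy_hex.one_le_expSum u
  have hκ0 : 0 < κ := by linarith
  set X := expSum threeOffsets (fun _ => 1 / 3) u with hXdef
  set ρ := Real.exp (pair u (1 / 3, 1 / 3)) * X / √κ with hρ
  have hρ1 : |ρ - 1| ≤ B * l1Norm δ := by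
    have h1 := abs_div_sqrt_sub_one_le (Q := Real.exp (pair u (1 / 3, 1 / 3)) * X) hκ1
    have h2 := abs_exp_mul_expSum_threeOffsets_sub_one_le hu
    have h3 := isLazy_hex.expSum_sub_one_le hu
    calc _ ≤ _ := h1
      _ ≤ oneNorm u * Real.exp C + oneNorm u * Real.exp C := add_le_add h2 h3
      _ = 2 * Real.exp C * oneNorm u := by ring
      _ ≤ 2 * Real.exp C * (C * l1Norm δ) := by gcongr
      _ = B * l1Norm δ := by rw [hB]; ring
  have hl1 : 0 ≤ l1Norm δ := oneNorm_nonneg (coords δ)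
  have hl2 : l1Norm δ ≤ 2 := by unfold l1Norm; linarith
  have hρ2 : |ρ| ≤ 1 + 2 * B := by
    have e : ρ = 1 + (ρ - 1) := by ring
    rw [e]
    refine (abs_add_le _ _).trans ?_
    rw [abs_one]
    nlinarith
  -- The exact prefactor is `ρ n J`, and `n J` is close to `2σ`; the splitting separates the errors
  -- of `ρ` and `σ` in `δ` from the error in `1 / n`.
  refine ⟨2 * σ * ρ - 3 * √3, ρ * (n * J - 2 * σ), ?_, ?_, ?_⟩
  · have e : 2 * σ * ρ - 3 * √3 = 2 * σ * (ρ - 1) + 2 * (σ - 3 * √3 / 2) := by ring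
    rw [e]
    refine (abs_add_le _ _).trans ?_
    rw [abs_mul (2 * σ), abs_mul 2 (σ - _), abs_two, abs_of_nonneg (a := 2 * σ) (by positivity)]
    calc _ ≤ 2 * C * (B * l1Norm δ) + 2 * (C * l1Norm δ) := by gcongr
      _ = (2 * C * B + 2 * C) * l1Norm δ := by ring
      _ ≤ _ := by
        refine mul_le_mul_of_nonneg_right ?_ hl1
        have : 0 < (1 + 2 * B) * (12 * C + 2 * Real.pi) := by positivity
        linarith
  · rw [abs_mul]
    have h1 := abs_odd_mul_sub_le hC hJpi hσ0 hσC hJσ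
    rw [← hn] at h1
    calc _ ≤ (1 + 2 * B) * ((12 * C + 2 * Real.pi) * (n : ℝ)⁻¹) := by gcongr
      _ = (1 + 2 * B) * (12 * C + 2 * Real.pi) * (n : ℝ)⁻¹ := by ring
      _ ≤ _ := by
        refine mul_le_mul_of_nonneg_right ?_ (by positivity)
        have : 0 < 2 * C * B + 2 * C := by positivity
        linarith
  · have hp : (n : ℝ) / 2 * pair u (coords δ) =
        pair u (shift 0 y) + pair u (1 / 3, 1 / 3) := by
      rw [hδ]
      simp only [pair, shift, Prod.fst_zero, Prod.snd_zero]
      field_simp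
      ring
    have hpow : κ ^ ((n : ℝ) / 2) = κ ^ m * √κ := by
      rw [show (n : ℝ) / 2 = m + 1 / 2 by rw [hnm]; ring, Real.rpow_add hκ0, Real.rpow_natCast,
        Real.sqrt_eq_rpow]
    have hsκ : 0 < √κ := Real.sqrt_pos.2 hκ0
    rw [hJ, hrate, exp_neg_mul_sub_log hκ0, hp, hpow, neg_add, Real.exp_add,
      Real.exp_neg (pair u (1 / 3, 1 / 3)), hρ]
    field_simp
    ring

end LatticeWalk

end

/-! ### Assembly of the two lattices, with the parity cases of the hexagonal walk -/

open LatticeWalk in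
theorem mainTheorem6 :
    -- the walk on the hexagonal lattice is irreducible, of period two, with classes `X₀`, `X₁`
    (IsIrreducibleWalk hexStep ∧ IsPeriod hexStep hexZero 2 ∧
      periodClass hexStep hexZero 2 0 = {x | tau x.1 = 0} ∧
      periodClass hexStep hexZero 2 1 = {x | tau x.1 = 2}) ∧
    -- the hexagonal lattice
    (∀ ε : ℝ, 0 < ε → ∃ C : ℝ, 0 < C ∧
      ∀ n : ℕ, 0 < n → ∀ j : ℕ, j < 2 → ∀ x ∈ periodClass hexStep hexZero 2 j,
        (n ≡ j [MOD 2] →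
          hexDelta n x ∈ stepBody hexTwoStepLaw →
          ε ≤ Metric.infDist (hexDelta n x) (frontier (stepBody hexTwoStepLaw)) →
          ∃ E₁ E₂ : ℝ, |E₁| ≤ C * l1Norm (hexDelta n x) ∧ |E₂| ≤ C * (n : ℝ)⁻¹ ∧
            nStep hexStep n hexZero x =
              (2 * Real.pi * n)⁻¹ *
                Real.exp (-((n : ℝ) / 2) * rate hexTwoStepLaw (hexDelta n x)) *
                (3 * Real.sqrt 3 + E₁ + E₂)) ∧
        (¬ n ≡ j [MOD 2] → nStep hexStep n hexZero x = 0)) ∧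
    -- the triangular lattice
    (∀ ε : ℝ, 0 < ε → ∃ C : ℝ, 0 < C ∧
      ∀ n : ℕ, 0 < n → ∀ x : ℤ × ℤ,
        triDelta n x ∈ stepBody triLaw →
        ε ≤ Metric.infDist (triDelta n x) (frontier (stepBody triLaw)) →
        ∃ E₁ E₂ : ℝ, |E₁| ≤ C * l1Norm (triDelta n x) ∧ |E₂| ≤ C * (n : ℝ)⁻¹ ∧
          nStep triStep n (0, 0) x =
            (2 * Real.pi * n)⁻¹ *
              Real.exp (-(n : ℝ) * rate triLaw (triDelta n x)) *
              (Real.sqrt 3 + E₁ + E₂)) := by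
  refine ⟨⟨isIrreducibleWalk_hexStep, isPeriod_hexStep, periodClass_zero, periodClass_one⟩,
    fun ε hε => ?_, fun ε hε => triangular_local_limit hε⟩
  obtain ⟨C₀, hC₀, H₀⟩ := hexagonal_local_limit_even hε
  obtain ⟨C₁, hC₁, H₁⟩ := hexagonal_local_limit_odd hε
  refine ⟨max C₀ C₁, lt_max_of_lt_left hC₀, fun n hn j hj x hx => ?_⟩
  have mono : ∀ {C s E : ℝ}, 0 ≤ s → C ≤ max C₀ C₁ → |E| ≤ C * s → |E| ≤ max C₀ C₁ * s :=
    fun hs hC hE => hE.trans (mul_le_mul_of_nonneg_right hC hs)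
  have hl : ∀ δ, 0 ≤ l1Norm δ := fun δ => oneNorm_nonneg (coords δ)
  have hninv : 0 ≤ (n : ℝ)⁻¹ := by positivity
  obtain rfl | rfl : j = 0 ∨ j = 1 := by omega
  · rw [periodClass_zero] at hx
    obtain ⟨y, rfl⟩ := exists_eq_evenVertex hx
    refine ⟨fun hmod hb hd => ?_, fun hmod => ?_⟩
    · obtain ⟨m, rfl⟩ : ∃ m, n = 2 * m := (Nat.modEq_zero_iff_dvd.1 hmod)
      obtain ⟨E₁, E₂, h1, h2, h3⟩ := H₀ m (by omega) y hb hd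
      exact ⟨E₁, E₂, mono (hl _) (le_max_left _ _) h1, mono hninv (le_max_left _ _) h2, h3⟩
    · refine (nStep_eq_zero_of_parity n y).2 fun he => hmod ?_
      exact Nat.modEq_zero_iff_dvd.2 (even_iff_two_dvd.1 he)
  · rw [periodClass_one] at hx
    obtain ⟨y, rfl⟩ := exists_eq_oddVertex hx
    refine ⟨fun hmod hb hd => ?_, fun hmod => ?_⟩
    · obtain ⟨m, rfl⟩ : ∃ m, n = 2 * m + 1 := ⟨n / 2, by unfold Nat.ModEq at hmod; omega⟩
      obtain ⟨E₁, E₂, h1, h2, h3⟩ := H₁ m y hb hd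
      exact ⟨E₁, E₂, mono (hl _) (le_max_right _ _) h1, mono hninv (le_max_right _ _) h2, h3⟩
    · refine (nStep_eq_zero_of_parity n y).1 ?_
      rw [Nat.even_iff]
      unfold Nat.ModEq at hmod
      omega
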